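/- Let $n,k$ be integers with $k\ge 2$, let $[n]=\{1,\dots,n\}$, and let $\mathcal F\subset\binom{[n]}{k}$ be an intersecting family of $k$-subsets of $[n]$, i.e. $F\cap F'\ne\emptyset$ for all $F,F'\in\mathcal F$. Let $\Delta(\mathcal F)=\max_{x\in[n]}|\{F\in\mathcal F: x\in F\}|$ be its maximum degree and $\gamma(\mathcal F)=|\mathcal F|-\Delta(\mathcal F)$ its diversity. Suppose that for some real $\alpha$ with $0\le\alpha<1$ $$\gamma(\mathcal F)=(1-\alpha)\binom{n-3}{k-2}\qquad\text{and}\qquad n\ \ge\ \max\{k+4,40\}\cdot\frac{k}{1-\alpha}.$$ Then there exist three distinct elements $u,v,w\in[n]$ such that $$\mathcal F\subset\mathcal F^*_{uvw}:=\Bigl\{F\in\tbinom{[n]}{k}:|F\cap\{u,v,w\}|\ge 2\Bigr\}$$ and $$|\mathcal F_{uvw}\setminus\mathcal F|\le 3\alpha\binom{n-3}{k-2},\qquad\text{where}\quad \mathcal F_{uvw}:=\Bigl\{F\in\tbinom{[n]}{k}:|F\cap\{u,v,w\}|=2\Bigr\}.$$ -/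

import Mathlib

/-- The degree `|F(x)|` of the point `x` in the family `F`: the number of members containing `x`. -/
def famDegree {n : ℕ} (F : Finset (Finset (Fin n))) (x : Fin n) : ℕ :=
  (F.filter (fun A => x ∈ A)).card

/-- The maximum degree `Δ(F)` of a family of subsets of an `n`-element set. -/
def famMaxDegree {n : ℕ} (F : Finset (Finset (Fin n))) : ℕ :=
  Finset.univ.sup (famDegree F)

/-- The diversity `γ(F) = |F| - Δ(F)`, as an integer (it is never negative). -/
def famDiversity {n : ℕ} (F : Finset (Finset (Fin n))) : ℤ :=
  (F.card : ℤ) - (famMaxDegree F : ℤ)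

/-- The pure triangle family `F_{uvw}`: the `k`-subsets meeting `{u, v, w}` in exactly two points. -/
def triangleFamily (n k : ℕ) (u v w : Fin n) : Finset (Finset (Fin n)) :=
  (Finset.univ.powersetCard k).filter
    (fun A => (A ∩ ({u, v, w} : Finset (Fin n))).card = 2)

/-- The family `F*_{uvw}`: the `k`-subsets meeting `{u, v, w}` in at least two points. -/
def triangleFamilyStar (n k : ℕ) (u v w : Fin n) : Finset (Finset (Fin n)) :=
  (Finset.univ.powersetCard k).filter
    (fun A => 2 ≤ (A ∩ ({u, v, w} : Finset (Fin n))).card)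

/-! Write U = C(n-3, k-3) = `supCount n k 3`, the number of k-sets through three given points. For k
≥ 3, C(n-3, k-2)(k-2) = U(n-k), so the bound on n makes the diversity at least 39U and at least
(k+5)U. Each further prescribed point divides such a count by at least 40.

The engine is shifting. For cross-intersecting families, one of them shifted, any members A, B
satisfy |A ∩ [t]| + |B ∩ [t]| > t for some t (`exists_lt_card_inter_smallest`). Hence one family
consists of sets dense on initial segments, and apart from sets through the first point the shortest
segments dominate their number.

`exists_heavy_pair`: some pair has degree at least 5U. Otherwise shift as long as all pair degrees
stay below 5U. A shift breaking this bound reveals a pair of degree at least 5U/2, which at most 2U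
members avoid (`cnt_avoid_pair_le`), and the family is too large for that. So the family can be
shifted fully, and density bounds its size by less than 39U.

`exists_third_point`: for a heavy pair x, y, nearly all members missing x contain y and conversely.
These two large halves cross-intersect, which forces a common point z; the remaining exceptions are
then excluded by counting. For k = 2, where U = 0, the triangle is found directly.

Finally, members missing one vertex contain the other two. There are C(n-3, k-2) such sets and at
least γ of them lie in the family, so at most α C(n-3, k-2) are absent for each vertex. -/

/-- The number of members of `F` with the property `p`. -/
noncomputable def cnt {β : Type*} (F : Finset β) (p : β → Prop) : ℕ :=
  open Classical in (F.filter p).card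

section Counting

variable {β : Type*} {F G : Finset β} {p q s t : β → Prop}

theorem cnt_eq_card_filter (F : Finset β) (p : β → Prop) [DecidablePred p] :
    cnt F p = (F.filter p).card := by
  unfold cnt
  congr

theorem cnt_true (F : Finset β) : cnt F (fun _ => True) = F.card := by
  classical simp [cnt]

theorem cnt_mono (h : ∀ A ∈ F, p A → q A) : cnt F p ≤ cnt F q := by
  classical
  unfold cnt
  refine Finset.card_le_card fun A hA => ?_
  rw [Finset.mem_filter] at hA ⊢
  exact ⟨hA.1, h A hA.1 hA.2⟩

theorem cnt_congr (h : ∀ A ∈ F, p A ↔ q A) : cnt F p = cnt F q :=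
  le_antisymm (cnt_mono fun A hA => (h A hA).1) (cnt_mono fun A hA => (h A hA).2)

theorem cnt_subset (h : F ⊆ G) : cnt F p ≤ cnt G p := by
  classical exact Finset.card_le_card (Finset.filter_subset_filter _ h)

theorem cnt_sdiff_add_cnt [DecidableEq β] (h : F ⊆ G) :
    cnt (G \ F) p + cnt F p = cnt G p := by
  classical
  unfold cnt
  rw [← Finset.card_union_of_disjoint
    (Finset.disjoint_filter_filter Finset.sdiff_disjoint), ← Finset.filter_union,
    Finset.sdiff_union_of_subset h]

theorem cnt_le_add (h : ∀ A ∈ F, p A → q A ∨ s A) : cnt F p ≤ cnt F q + cnt F s := by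
  classical
  unfold cnt
  refine (Finset.card_le_card (t := F.filter q ∪ F.filter s) fun A hA => ?_).trans
    (Finset.card_union_le _ _)
  rw [Finset.mem_filter] at hA
  rw [Finset.mem_union, Finset.mem_filter, Finset.mem_filter]
  exact (h A hA.1 hA.2).imp (fun h => ⟨hA.1, h⟩) (fun h => ⟨hA.1, h⟩)

theorem cnt_le_add_add (h : ∀ A ∈ F, p A → q A ∨ s A ∨ t A) :
    cnt F p ≤ cnt F q + cnt F s + cnt F t := by
  have h1 : cnt F p ≤ cnt F q + cnt F (fun A => s A ∨ t A) := cnt_le_add h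
  have h2 : cnt F (fun A => s A ∨ t A) ≤ cnt F s + cnt F t := cnt_le_add fun _ _ h => h
  omega

theorem exists_of_cnt_pos (h : 0 < cnt F p) : ∃ A ∈ F, p A := by
  classical
  unfold cnt at h
  obtain ⟨A, hA⟩ := Finset.card_pos.1 h
  rw [Finset.mem_filter] at hA
  exact ⟨A, hA⟩

theorem cnt_pos {A : β} (hA : A ∈ F) (h : p A) : 0 < cnt F p := by
  classical exact Finset.card_pos.2 ⟨A, Finset.mem_filter.2 ⟨hA, h⟩⟩

theorem cnt_eq_zero (h : ∀ A ∈ F, ¬ p A) : cnt F p = 0 := by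
  by_contra h0
  obtain ⟨A, hA, hp⟩ := exists_of_cnt_pos (Nat.pos_of_ne_zero h0)
  exact h A hA hp

theorem cnt_le_sum {ι : Type*} (T : Finset ι) (r : ι → β → Prop)
    (h : ∀ A ∈ F, p A → ∃ i ∈ T, r i A) : cnt F p ≤ ∑ i ∈ T, cnt F (r i) := by
  classical
  unfold cnt
  refine (Finset.card_le_card (t := T.biUnion fun i => F.filter (r i)) fun A hA => ?_).trans
    Finset.card_biUnion_le
  rw [Finset.mem_filter] at hA
  obtain ⟨i, hi, hr⟩ := h A hA.1 hA.2
  exact Finset.mem_biUnion.2 ⟨i, hi, Finset.mem_filter.2 ⟨hA.1, hr⟩⟩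

theorem cnt_filter [DecidablePred q] : cnt (F.filter q) p = cnt F (fun A => q A ∧ p A) := by
  classical
  unfold cnt
  rw [Finset.filter_filter]
  congr

end Counting

/-! ### Shifts and what they preserve -/

section Shifting

variable {α : Type*} [DecidableEq α]

/-- The families any two members of which meet. -/
def Meets (F : Finset (Finset α)) : Prop := ∀ A ∈ F, ∀ B ∈ F, (A ∩ B).Nonempty

theorem Meets.subset {F G : Finset (Finset α)} (h : Meets G) (hFG : F ⊆ G) : Meets F :=
  fun A hA B hB => h A (hFG hA) B (hFG hB)

/-- Replacing `j` by `i` throughout the family, wherever this gives a new set. -/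
abbrev shiftFam (i j : α) (F : Finset (Finset α)) : Finset (Finset α) :=
  UV.compression {i} {j} F

theorem compress_singleton_eq {i j : α} (hij : i ≠ j) (A : Finset α) :
    UV.compress {i} {j} A = if i ∉ A ∧ j ∈ A then insert i (A.erase j) else A := by
  unfold UV.compress
  have h : (Disjoint {i} A ∧ ({j} : Finset α) ≤ A) ↔ (i ∉ A ∧ j ∈ A) := by simp
  by_cases hc : i ∉ A ∧ j ∈ A
  · rw [if_pos hc, if_pos (h.2 hc)]
    ext z
    simp only [Finset.sup_eq_union, Finset.mem_sdiff, Finset.mem_union, Finset.mem_singleton,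
      Finset.mem_insert, Finset.mem_erase]
    constructor
    · tauto
    · rintro (rfl | ⟨h1, h2⟩)
      · exact ⟨Or.inr rfl, hij⟩
      · exact ⟨Or.inl h2, h1⟩
  · rw [if_neg hc, if_neg (fun h' => hc (h.1 h'))]

theorem mem_shiftFam_cases {i j : α} (hij : i ≠ j) {F : Finset (Finset α)} {A : Finset α}
    (hA : A ∈ shiftFam i j F) :
    (A ∈ F ∧ (i ∉ A → j ∈ A → insert i (A.erase j) ∈ F)) ∨
      (A ∉ F ∧ i ∈ A ∧ j ∉ A ∧ insert j (A.erase i) ∈ F) := by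
  rw [shiftFam, UV.mem_compression] at hA
  rcases hA with ⟨h1, h2⟩ | ⟨h1, B, hB, rfl⟩
  · refine Or.inl ⟨h1, fun hi hj => ?_⟩
    rwa [compress_singleton_eq hij, if_pos ⟨hi, hj⟩] at h2
  · rw [compress_singleton_eq hij] at h1 ⊢
    split_ifs at h1 ⊢ with hc
    · refine Or.inr ⟨h1, by simp, by simp [hij.symm], ?_⟩
      rw [Finset.erase_insert (by simp [hc.1]), Finset.insert_erase hc.2]
      exact hB
    · exact absurd hB h1

/-- Only a new set A against a retained set B matters. If B contains j but not i, its own shift is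
in the family and meets the preimage of A in a point other than i and j, which is common to A and B.
If B contains neither, it meets the preimage of A away from j. -/
theorem Meets.shiftFam {i j : α} (hij : i ≠ j) {F : Finset (Finset α)} (hF : Meets F) :
    Meets (shiftFam i j F) := by
  have key : ∀ A B : Finset α, i ∈ A → j ∉ A → insert j (A.erase i) ∈ F → B ∈ F →
      (i ∉ B → j ∈ B → insert i (B.erase j) ∈ F) → (A ∩ B).Nonempty := by
    intro A B hiA hjA hA hB hB'
    by_cases hiB : i ∈ B
    · exact ⟨i, Finset.mem_inter.2 ⟨hiA, hiB⟩⟩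
    by_cases hjB : j ∈ B
    · obtain ⟨w, hw⟩ := hF _ hA _ (hB' hiB hjB)
      refine ⟨w, ?_⟩
      simp only [Finset.mem_inter, Finset.mem_insert, Finset.mem_erase] at hw ⊢
      grind
    · obtain ⟨w, hw⟩ := hF _ hA _ hB
      refine ⟨w, ?_⟩
      simp only [Finset.mem_inter, Finset.mem_insert, Finset.mem_erase] at hw ⊢
      grind
  intro A hA B hB
  rcases mem_shiftFam_cases hij hA with ⟨hA1, hA2⟩ | ⟨-, hA1, hA2, hA3⟩ <;>
    rcases mem_shiftFam_cases hij hB with ⟨hB1, hB2⟩ | ⟨-, hB1, hB2, hB3⟩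
  · exact hF _ hA1 _ hB1
  · rw [Finset.inter_comm]
    exact key B A hB1 hB2 hB3 hA1 hA2
  · exact key A B hA1 hA2 hA3 hB1 hB2
  · exact ⟨i, Finset.mem_inter.2 ⟨hA1, hB1⟩⟩

theorem shiftFam_card_eq {k : ℕ} (i j : α) {F : Finset (Finset α)}
    (hF : ∀ A ∈ F, A.card = k) : ∀ A ∈ shiftFam i j F, A.card = k := by
  have h : (F : Set (Finset α)).Sized k := fun A hA => hF A hA
  intro A hA
  exact h.uvCompression (u := {i}) (v := {j}) (by simp) hA

/-- A property of sets that does not change when `j` is replaced by `i`. -/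
def SwapInvariant (i j : α) (p : Finset α → Prop) : Prop :=
  ∀ A, i ∉ A → j ∈ A → (p (insert i (A.erase j)) ↔ p A)

/-- For an invariant property, filtering commutes with compression, and compression preserves
cardinality. -/
theorem cnt_shiftFam {i j : α} (hij : i ≠ j) (F : Finset (Finset α)) {p : Finset α → Prop}
    (hp : SwapInvariant i j p) : cnt (shiftFam i j F) p = cnt F p := by
  classical
  have hp' : ∀ A, p (UV.compress {i} {j} A) ↔ p A := by
    intro A
    rw [compress_singleton_eq hij]
    split_ifs with h
    · exact hp A h.1 h.2
    · rfl
  have : (shiftFam i j F).filter p = shiftFam i j (F.filter p) := by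
    ext A
    simp only [shiftFam, Finset.mem_filter, UV.mem_compression, hp']
    constructor
    · rintro ⟨h | ⟨h, B, hB, rfl⟩, hA⟩
      · exact Or.inl ⟨⟨h.1, hA⟩, h.2, hA⟩
      · exact Or.inr ⟨fun h' => h h'.1, B, ⟨hB, (hp' B).1 hA⟩, rfl⟩
    · rintro (h | ⟨h, B, hB, rfl⟩)
      · exact ⟨Or.inl ⟨h.1.1, h.2.1⟩, h.1.2⟩
      · exact ⟨Or.inr ⟨fun h' => h ⟨h', (hp' B).2 hB.2⟩, B, hB.1, rfl⟩, (hp' B).2 hB.2⟩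
  unfold cnt
  rw [this, shiftFam, UV.card_compression]

theorem swapInvariant_of_notMem {i j : α} {x : α} (hi : x ≠ i) (hj : x ≠ j) :
    SwapInvariant i j (fun A => x ∈ A) := by
  intro A _ _
  simp [hi, hj]

theorem SwapInvariant.and {i j : α} {p q : Finset α → Prop} (hp : SwapInvariant i j p)
    (hq : SwapInvariant i j q) : SwapInvariant i j (fun A => p A ∧ q A) :=
  fun A hi hj => and_congr (hp A hi hj) (hq A hi hj)

theorem SwapInvariant.not {i j : α} {p : Finset α → Prop} (hp : SwapInvariant i j p) :
    SwapInvariant i j (fun A => ¬ p A) :=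
  fun A hi hj => not_congr (hp A hi hj)

theorem swapInvariant_or (i j : α) :
    SwapInvariant i j (fun A => i ∈ A ∨ j ∈ A) := by
  intro A hi hj
  simp [hj]

/-- Families closed under replacing an element of `V` by a smaller one. -/
def ShiftStable [LT α] (V : Finset α) (F : Finset (Finset α)) : Prop :=
  ∀ i ∈ V, ∀ j ∈ V, i < j → shiftFam i j F = F

theorem ShiftStable.insert_erase_mem [Preorder α] {V : Finset α} {F : Finset (Finset α)}
    (h : ShiftStable V F) {i j : α} (hi : i ∈ V) (hj : j ∈ V) (hij : i < j) {A : Finset α}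
    (hA : A ∈ F) (hiA : i ∉ A) (hjA : j ∈ A) : insert i (A.erase j) ∈ F := by
  have h1 : UV.compress {i} {j} A ∈ UV.compression {i} {j} F := UV.compress_mem_compression hA
  rw [compress_singleton_eq hij.ne, if_pos ⟨hiA, hjA⟩] at h1
  rw [← h i hi j hj hij]
  exact h1

end Shifting

/-- Among the families with the property `P`, one can be chosen all of whose nontrivial shifts
lose the property. -/
theorem exists_shift_minimal {n : ℕ} (V : Finset (Fin n)) (P : Finset (Finset (Fin n)) → Prop)
    {F₀ : Finset (Finset (Fin n))} (h₀ : P F₀) :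
    ∃ F, P F ∧ ∀ i ∈ V, ∀ j ∈ V, i < j → shiftFam i j F = F ∨ ¬ P (shiftFam i j F) := by
  -- This potential drops strictly under every shift that changes the family, so a minimiser will
  -- do.
  let w : Finset (Finset (Fin n)) → ℕ := fun F => ∑ A ∈ F, ∑ a ∈ A, a.val
  obtain ⟨F, hF, hmin⟩ := WellFounded.has_min (measure w).wf {F | P F} ⟨F₀, h₀⟩
  refine ⟨F, hF, fun i _ j _ hij => ?_⟩
  by_contra hcon
  push Not at hcon
  obtain ⟨hne, hP⟩ := hcon
  refine hmin _ hP ?_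
  change w (shiftFam i j F) < w F
  have hlt : ∀ A : Finset (Fin n), UV.compress {i} {j} A ≠ A →
      ∑ a ∈ UV.compress {i} {j} A, a.val < ∑ a ∈ A, a.val := by
    intro A hA
    rw [compress_singleton_eq hij.ne] at hA ⊢
    split_ifs at hA ⊢ with hc
    · rw [Finset.sum_insert (by simp [hc.1]), ← Finset.add_sum_erase A _ hc.2]
      exact Nat.add_lt_add_right hij _
    · exact absurd rfl hA
  let F1 := F.filter fun A => UV.compress {i} {j} A ∈ F
  let F2 := F.filter fun A => UV.compress {i} {j} A ∉ F
  have hsplit : w F = w F1 + w F2 := (Finset.sum_filter_add_sum_filter_not F _ _).symm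
  have himg : {a ∈ F.image (UV.compress {i} {j}) | a ∉ F} = F2.image (UV.compress {i} {j}) := by
    rw [Finset.filter_image]
  have hshift : w (shiftFam i j F) = w F1 + ∑ A ∈ F2, ∑ a ∈ UV.compress {i} {j} A, a.val := by
    change ∑ A ∈ UV.compression {i} {j} F, _ = _
    rw [UV.compression, Finset.sum_union UV.compress_disjoint, himg, Finset.sum_image]
    intro A hA B hB hAB
    exact UV.compress_injOn (by simpa [F2] using hA) (by simpa [F2] using hB) hAB
  have hne2 : F2.Nonempty := by
    by_contra hemp
    rw [Finset.not_nonempty_iff_eq_empty] at hemp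
    apply hne
    change UV.compression {i} {j} F = F
    rw [UV.compression, himg, hemp, Finset.image_empty, Finset.union_empty, Finset.filter_eq_self]
    intro A hA
    by_contra hc
    have : A ∈ F2 := Finset.mem_filter.2 ⟨hA, hc⟩
    simp [hemp] at this
  rw [hsplit, hshift]
  refine Nat.add_lt_add_left (Finset.sum_lt_sum_of_nonempty hne2 fun A hA => hlt A fun h => ?_) _
  have := (Finset.mem_filter.1 hA)
  rw [h] at this
  exact this.2 this.1

/-! ### Initial segments and the walk lemma -/

section Prefixes

variable {α : Type*} [LinearOrder α]

/-- The `t` smallest elements of `V` (all of `V` if `t` exceeds its cardinality). -/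
def smallest (V : Finset α) (t : ℕ) : Finset α :=
  V.filter fun z => (V.filter (· < z)).card < t

theorem smallest_subset (V : Finset α) (t : ℕ) : smallest V t ⊆ V := Finset.filter_subset _ _

theorem smallest_mono (V : Finset α) {s t : ℕ} (h : s ≤ t) : smallest V s ⊆ smallest V t := by
  intro z hz
  rw [smallest, Finset.mem_filter] at hz ⊢
  exact ⟨hz.1, hz.2.trans_le h⟩

theorem card_filter_lt_strictMonoOn (V : Finset α) {y z : α} (hy : y ∈ V) (hyz : y < z) :
    (V.filter (· < y)).card < (V.filter (· < z)).card := by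
  refine Finset.card_lt_card ⟨fun w hw => ?_, fun h => ?_⟩
  · rw [Finset.mem_filter] at hw ⊢
    exact ⟨hw.1, hw.2.trans hyz⟩
  · have := h (Finset.mem_filter.2 ⟨hy, hyz⟩)
    exact lt_irrefl y (Finset.mem_filter.1 this).2

theorem card_filter_lt_injOn (V : Finset α) :
    Set.InjOn (fun z => (V.filter (· < z)).card) V := by
  intro y hy z hz h
  rcases lt_trichotomy y z with h1 | h1 | h1
  · exact absurd h (card_filter_lt_strictMonoOn V hy h1).ne
  · exact h1
  · exact absurd h (card_filter_lt_strictMonoOn V hz h1).ne'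

theorem image_card_filter_lt (V : Finset α) :
    V.image (fun z => (V.filter (· < z)).card) = Finset.range V.card := by
  refine Finset.eq_of_subset_of_card_le (fun m hm => ?_) ?_
  · obtain ⟨z, hz, rfl⟩ := Finset.mem_image.1 hm
    rw [Finset.mem_range]
    refine Finset.card_lt_card ⟨Finset.filter_subset _ _, fun h => ?_⟩
    exact lt_irrefl z (Finset.mem_filter.1 (h hz)).2
  · rw [Finset.card_image_of_injOn (card_filter_lt_injOn V), Finset.card_range]

theorem card_smallest (V : Finset α) {t : ℕ} (ht : t ≤ V.card) : (smallest V t).card = t := by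
  have himg : (smallest V t).image (fun z => (V.filter (· < z)).card) = Finset.range t := by
    ext m
    rw [Finset.mem_image, Finset.mem_range]
    constructor
    · rintro ⟨z, hz, rfl⟩
      exact (Finset.mem_filter.1 hz).2
    · intro hm
      have : m ∈ V.image (fun z => (V.filter (· < z)).card) := by
        rw [image_card_filter_lt, Finset.mem_range]
        omega
      obtain ⟨z, hz, rfl⟩ := Finset.mem_image.1 this
      exact ⟨z, Finset.mem_filter.2 ⟨hz, hm⟩, rfl⟩
  rw [← Finset.card_image_of_injOn ((card_filter_lt_injOn V).mono (smallest_subset V t)), himg,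
    Finset.card_range]

theorem smallest_eq_self (V : Finset α) {t : ℕ} (ht : V.card ≤ t) : smallest V t = V :=
  Finset.Subset.antisymm (smallest_subset V t) fun z hz =>
    Finset.mem_filter.2 ⟨hz, lt_of_lt_of_le (Finset.card_lt_card
      ⟨Finset.filter_subset _ _, fun h => lt_irrefl z (Finset.mem_filter.1 (h hz)).2⟩) ht⟩

theorem card_smallest_le (V : Finset α) (t : ℕ) : (smallest V t).card ≤ t := by
  rcases le_total t V.card with h | h
  · exact (card_smallest V h).le
  · rw [smallest_eq_self V h]
    exact h

theorem card_smallest_sdiff_one_le (V : Finset α) (m : ℕ) :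
    (smallest V (2 * m + 1) \ smallest V 1).card ≤ 2 * m := by
  rcases Nat.eq_zero_or_pos V.card with h | h
  · have := Finset.card_le_card (Finset.sdiff_subset.trans (smallest_subset V (2 * m + 1)) :
      smallest V (2 * m + 1) \ smallest V 1 ⊆ V)
    omega
  · rw [Finset.card_sdiff_of_subset (smallest_mono V (by omega)), card_smallest V h]
    have := card_smallest_le V (2 * m + 1)
    omega

theorem exists_smallest_one_eq (V : Finset α) (h : 1 ≤ V.card) : ∃ v ∈ V, smallest V 1 = {v} := by
  obtain ⟨v, hv⟩ := Finset.card_eq_one.1 (card_smallest V h)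
  exact ⟨v, smallest_subset V 1 (hv ▸ Finset.mem_singleton_self v), hv⟩

theorem exists_smallest_three_sdiff_eq (V : Finset α) (h : 3 ≤ V.card) :
    ∃ c ∈ V, ∃ d ∈ V, c ≠ d ∧ smallest V 3 \ smallest V 1 = {c, d} := by
  have h1 : (smallest V 3 \ smallest V 1).card = 2 := by
    rw [Finset.card_sdiff_of_subset (smallest_mono V (by omega)), card_smallest V h,
      card_smallest V (by omega)]
  have h2 := (Finset.sdiff_subset.trans (smallest_subset V 3) : smallest V 3 \ smallest V 1 ⊆ V)
  obtain ⟨c, d, hcd, he⟩ := Finset.card_eq_two.1 h1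
  rw [he] at h2
  exact ⟨c, h2 (by simp), d, h2 (by simp), hcd, he⟩

/-- Two members of cross-intersecting families, one of them stable under shifts, have between them
more than `t` points among the first `t` elements of the ground set, for some `t`. -/
theorem exists_lt_card_inter_smallest {V : Finset α} {𝒜 ℬ : Finset α → Prop}
    (hstab : ∀ A, 𝒜 A → ∀ i ∈ V, ∀ j ∈ V, i < j → i ∉ A → j ∈ A → 𝒜 (insert i (A.erase j)))
    (hcross : ∀ A, 𝒜 A → ∀ B, ℬ B → (A ∩ B ∩ V).Nonempty)
    {A B : Finset α} (hA : 𝒜 A) (hB : ℬ B) :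
    ∃ t, t < (A ∩ smallest V t).card + (B ∩ smallest V t).card := by
  -- Assume the two counts sum to at most t for every t. Moving the first common point j of A to an
  -- earlier point i outside A ∪ B preserves all these inequalities and lowers |A ∩ B ∩ V|, until
  -- cross-intersection fails.
  by_contra hcon
  push Not at hcon
  generalize hs : (A ∩ B ∩ V).card = s
  induction s generalizing A with
  | zero =>
    have := hcross A hA B hB
    rw [Finset.card_eq_zero] at hs
    simp [hs] at this
  | succ s ih =>
    set ρ : α → ℕ := fun z => (V.filter (· < z)).card with hρ
    obtain ⟨j, hj, hjmin⟩ := (A ∩ B ∩ V).exists_min_image id (Finset.card_pos.1 (by omega))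
    simp only [Finset.mem_inter, id] at hj hjmin
    obtain ⟨⟨hjA, hjB⟩, hjV⟩ := hj
    have hmem : ∀ z t, z ∈ smallest V t ↔ z ∈ V ∧ ρ z < t := fun z t => Finset.mem_filter
    have hρj : ρ j + 1 ≤ V.card := by
      have : ρ j ∈ Finset.range V.card := by
        rw [← image_card_filter_lt]
        exact Finset.mem_image_of_mem _ hjV
      exact Finset.mem_range.1 this
    have hcards : ∀ S : Finset α, (A ∩ S).card + (B ∩ S).card
        = ((A ∪ B) ∩ S).card + (A ∩ B ∩ S).card := by
      intro S
      rw [← Finset.card_union_add_card_inter, ← Finset.union_inter_distrib_right]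
      congr 2
      ext z
      simp only [Finset.mem_inter]
      tauto
    -- If A ∪ B covered the first ρ j + 1 points, the doubly counted j would violate the inequality
    -- at t = ρ j + 1.
    have hex : ((smallest V (ρ j + 1)) \ (A ∪ B)).Nonempty := by
      rw [Finset.sdiff_nonempty]
      intro hsub
      have h1 := hcon (ρ j + 1)
      rw [hcards, Finset.inter_eq_right.2 hsub, card_smallest V hρj] at h1
      have : 0 < (A ∩ B ∩ smallest V (ρ j + 1)).card := by
        refine Finset.card_pos.2 ⟨j, ?_⟩
        simp only [Finset.mem_inter, hmem]
        exact ⟨⟨hjA, hjB⟩, hjV, by omega⟩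
      omega
    obtain ⟨i, hi, himax⟩ := ((smallest V (ρ j + 1)) \ (A ∪ B)).exists_max_image id hex
    simp only [Finset.mem_sdiff, Finset.mem_union, hmem, id] at hi himax
    obtain ⟨⟨hiV, hij⟩, hiAB⟩ := hi
    have hiA : i ∉ A := fun h => hiAB (Or.inl h)
    have hiB : i ∉ B := fun h => hiAB (Or.inr h)
    have hne : i ≠ j := fun h => hiA (h ▸ hjA)
    have hlt : i < j := by
      rcases lt_trichotomy i j with h | h | h
      · exact h
      · exact absurd h hne
      · have := card_filter_lt_strictMonoOn V hjV h
        have : ρ j < ρ i := this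
        omega
    have hmonoρ : ∀ y ∈ V, ∀ z ∈ V, ρ y ≤ ρ z → y ≤ z := by
      intro y hy z hz h
      by_contra hc
      have : ρ z < ρ y := card_filter_lt_strictMonoOn V hz (not_le.1 hc)
      omega
    have hρij : ρ i < ρ j := card_filter_lt_strictMonoOn V hiV hlt
    refine ih (hstab A hA i hiV j hjV hlt hiA hjA) (fun t => ?_) ?_
    -- Nothing changes for t ≤ ρ i. For ρ i < t ≤ ρ j no point is counted twice and i was not
    -- counted, so there is room for one more. Beyond ρ j the gain of i is offset by the loss of j.
    · by_cases ht1 : t ≤ ρ i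
      · have : insert i (A.erase j) ∩ smallest V t = A ∩ smallest V t := by
          ext z
          simp only [Finset.mem_inter, Finset.mem_insert, Finset.mem_erase, hmem]
          constructor
          · rintro ⟨rfl | h, h2, h3⟩
            · omega
            · exact ⟨h.2, h2, h3⟩
          · rintro ⟨h1, h2, h3⟩
            refine ⟨Or.inr ⟨?_, h1⟩, h2, h3⟩
            rintro rfl
            omega
        rw [this]
        exact hcon t
      have hinsle : (insert i (A.erase j) ∩ smallest V t).card ≤ (A ∩ smallest V t).card + 1 := by
        refine (Finset.card_le_card (t := insert i (A ∩ smallest V t)) fun z hz => ?_).trans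
          (Finset.card_insert_le _ _)
        simp only [Finset.mem_inter, Finset.mem_insert, Finset.mem_erase] at hz ⊢
        tauto
      by_cases ht2 : t ≤ ρ j
      · -- the elements ranked strictly between `i` and `t` lie in exactly one of the two sets
        have hsplit : ((A ∪ B) ∩ smallest V t) ⊆
            ((A ∪ B) ∩ smallest V (ρ i)) ∪ (smallest V t \ smallest V (ρ i + 1)) := by
          intro z hz
          simp only [Finset.mem_inter, Finset.mem_union, Finset.mem_sdiff, hmem] at hz ⊢
          rcases lt_trichotomy (ρ z) (ρ i) with h | h | h
          · exact Or.inl ⟨hz.1, hz.2.1, h⟩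
          · have : z = i := card_filter_lt_injOn V hz.2.1 hiV h
            subst this
            exact absurd hz.1 hiAB
          · exact Or.inr ⟨hz.2, fun h' => by omega⟩
        have hsplit' := (Finset.card_le_card hsplit).trans (Finset.card_union_le _ _)
        rw [Finset.card_sdiff_of_subset (smallest_mono V (by omega)),
          card_smallest V (by omega), card_smallest V (by omega)] at hsplit'
        have hzero : ∀ t ≤ ρ j, (A ∩ B ∩ smallest V t).card = 0 := by
          intro t ht
          rw [Finset.card_eq_zero, Finset.eq_empty_iff_forall_notMem]
          intro z hz
          simp only [Finset.mem_inter, hmem] at hz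
          have hle := hjmin z ⟨hz.1, hz.2.1⟩
          have : ρ j ≤ ρ z := by
            rcases hle.lt_or_eq with h | h
            · exact (card_filter_lt_strictMonoOn V hjV h).le
            · rw [h]
          omega
        have h1 := hcon (ρ i)
        have h2 := hcards (smallest V t)
        have h3 := hcards (smallest V (ρ i))
        rw [hzero t ht2] at h2
        rw [hzero _ hρij.le] at h3
        omega
      · have : (insert i (A.erase j) ∩ smallest V t).card ≤ (A ∩ smallest V t).card := by
          have hjt : j ∈ A ∩ smallest V t := by
            simp only [Finset.mem_inter, hmem]
            exact ⟨hjA, hjV, by omega⟩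
          have h2 : insert i (A.erase j) ∩ smallest V t ⊆
              insert i ((A ∩ smallest V t).erase j) := by
            intro z hz
            simp only [Finset.mem_inter, Finset.mem_insert, Finset.mem_erase] at hz ⊢
            tauto
          have h3 := (Finset.card_le_card h2).trans (Finset.card_insert_le _ _)
          rw [Finset.card_erase_of_mem hjt] at h3
          have := Finset.card_pos.2 ⟨j, hjt⟩
          omega
        have := hcon t
        omega
    · have : insert i (A.erase j) ∩ B ∩ V = (A ∩ B ∩ V).erase j := by
        ext z
        simp only [Finset.mem_inter, Finset.mem_insert, Finset.mem_erase]
        constructor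
        · rintro ⟨⟨rfl | h, h2⟩, h3⟩
          · exact absurd h2 hiB
          · exact ⟨h.1, ⟨h.2, h2⟩, h3⟩
        · rintro ⟨h1, ⟨h2, h3⟩, h4⟩
          exact ⟨⟨Or.inr ⟨h1, h2⟩, h3⟩, h4⟩
      rw [this, Finset.card_erase_of_mem (by simp [hjA, hjB, hjV])]
      omega

end Prefixes

/-! ### Counting sets through given points -/

/-- The number of `k`-subsets of an `n`-set that contain a given `s`-set. -/
def supCount (n k s : ℕ) : ℕ := (n - s).choose (n - k)

theorem supCount_succ_mul {n k s : ℕ} (hs : s < n) (hk : k ≤ n) :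
    supCount n k (s + 1) * (n - s) = supCount n k s * (k - s) := by
  have h := Nat.choose_mul_succ_eq (n - (s + 1)) (n - k)
  rw [show n - (s + 1) + 1 = n - s by omega] at h
  unfold supCount
  rcases le_total s k with h1 | h1
  · rw [h, show n - s - (n - k) = k - s by omega]
  · rw [h, show n - s - (n - k) = 0 by omega, show k - s = 0 by omega]

theorem mul_supCount_succ_le {n k s c : ℕ} (hs : s < n) (hk : k ≤ n)
    (hc : c * (k - s) ≤ n - s) : c * supCount n k (s + 1) ≤ supCount n k s := by
  have h := supCount_succ_mul hs hk
  have hpos : 0 < n - s := by omega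
  refine Nat.le_of_mul_le_mul_right ?_ hpos
  calc c * supCount n k (s + 1) * (n - s) = supCount n k s * (c * (k - s)) := by
        rw [mul_assoc, h]; ring
    _ ≤ supCount n k s * (n - s) := Nat.mul_le_mul_left _ hc

theorem forty_mul_supCount_le {n k : ℕ} (hk : 1 ≤ k) (hn : 40 * k ≤ n) (s : ℕ) :
    40 * supCount n k (s + 1) ≤ supCount n k s := by
  rcases lt_or_ge s k with h | h
  · exact mul_supCount_succ_le (by omega) (by omega) (by omega)
  -- For s ≥ k the lower index n - k exceeds the upper index, so the count vanishes.
  · have : supCount n k (s + 1) = 0 := Nat.choose_eq_zero_of_lt (by omega)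
    omega

section SupersetCounts

variable {n k : ℕ} {F : Finset (Finset (Fin n))}

theorem cnt_superset_le (hF : ∀ A ∈ F, A.card = k) (S : Finset (Fin n)) :
    cnt F (fun A => S ⊆ A) ≤ supCount n k S.card := by
  classical
  have h : ((F.filter fun A => S ⊆ A).image compl) ⊆ Finset.powersetCard (n - k) Sᶜ := by
    intro B hB
    obtain ⟨A, hA, rfl⟩ := Finset.mem_image.1 hB
    rw [Finset.mem_filter] at hA
    rw [Finset.mem_powersetCard]
    refine ⟨Finset.compl_subset_compl.2 hA.2, ?_⟩
    rw [Finset.card_compl, hF A hA.1, Fintype.card_fin]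
  have h2 := Finset.card_le_card h
  rw [Finset.card_image_of_injective _ compl_injective, Finset.card_powersetCard,
    Finset.card_compl, Fintype.card_fin] at h2
  rw [cnt_eq_card_filter]
  exact h2

theorem cnt_superset_inter_le (hF : ∀ A ∈ F, A.card = k) {S Q : Finset (Fin n)}
    (hSQ : Disjoint S Q) (s : ℕ) :
    cnt F (fun A => S ⊆ A ∧ s ≤ (A ∩ Q).card) ≤ Q.card.choose s * supCount n k (S.card + s) := by
  refine (cnt_le_sum (Finset.powersetCard s Q) (fun T A => S ∪ T ⊆ A) fun A _ hA => ?_).trans ?_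
  · obtain ⟨T, hT1, hT2⟩ := Finset.exists_subset_card_eq hA.2
    exact ⟨T, Finset.mem_powersetCard.2 ⟨hT1.trans Finset.inter_subset_right, hT2⟩,
      Finset.union_subset hA.1 (hT1.trans Finset.inter_subset_left)⟩
  · rw [← Finset.card_powersetCard, ← smul_eq_mul]
    refine Finset.sum_le_card_nsmul _ _ _ fun T hT => ?_
    rw [Finset.mem_powersetCard] at hT
    refine (cnt_superset_le hF (S ∪ T)).trans ?_
    rw [Finset.card_union_of_disjoint (hSQ.mono_right hT.1), hT.2]

/-- The sets meeting, for some `m ≥ m₀`, a given set of size about `2m` in at least `m` points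
are dominated by those doing so for `m = m₀`. -/
theorem cnt_exists_inter_le (hk : 1 ≤ k) (hn : 40 * k ≤ n) (hF : ∀ A ∈ F, A.card = k)
    {S : Finset (Fin n)} {Q : ℕ → Finset (Fin n)} (hSQ : ∀ m, Disjoint S (Q m)) {c : ℕ}
    (hQ : ∀ m, (Q m).card ≤ 2 * m + c) (q m₀ : ℕ) :
    9 * cnt F (fun A => S ⊆ A ∧ ∃ m ≥ m₀, m + q ≤ (A ∩ Q m).card) ≤
      10 * (2 ^ (2 * m₀ + c) * supCount n k (S.card + m₀ + q)) := by
  -- Induction on the length of the window for m. Raising m₀ by one multiplies the power of two by 4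
  -- and divides the superset count by at least 40: a geometric series of ratio 1/10 and sum 10/9.
  -- The window k + 1 suffices, as m ≤ |A| = k.
  have key : ∀ M m₀ : ℕ,
      9 * cnt F (fun A => S ⊆ A ∧ ∃ m ≥ m₀, m < m₀ + M ∧ m + q ≤ (A ∩ Q m).card) ≤
      10 * (2 ^ (2 * m₀ + c) * supCount n k (S.card + m₀ + q)) := by
    intro M
    induction M with
    | zero =>
      intro m₀
      rw [cnt_eq_zero]
      · simp
      · rintro A _ ⟨_, m, h1, h2, _⟩
        omega
    | succ M ih =>
      intro m₀
      have h1 : cnt F (fun A => S ⊆ A ∧ ∃ m ≥ m₀, m < m₀ + (M + 1) ∧ m + q ≤ (A ∩ Q m).card) ≤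
          cnt F (fun A => S ⊆ A ∧ m₀ + q ≤ (A ∩ Q m₀).card) +
          cnt F (fun A => S ⊆ A ∧ ∃ m ≥ m₀ + 1, m < m₀ + 1 + M ∧ m + q ≤ (A ∩ Q m).card) := by
        refine cnt_le_add ?_
        rintro A _ ⟨hS, m, h1, h2, h3⟩
        rcases h1.eq_or_lt with rfl | h
        · exact Or.inl ⟨hS, h3⟩
        · exact Or.inr ⟨hS, m, h, by omega, h3⟩
      have h2 : cnt F (fun A => S ⊆ A ∧ m₀ + q ≤ (A ∩ Q m₀).card) ≤
          2 ^ (2 * m₀ + c) * supCount n k (S.card + m₀ + q) := by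
        refine (cnt_superset_inter_le hF (hSQ m₀) (m₀ + q)).trans ?_
        rw [← add_assoc]
        exact Nat.mul_le_mul_right _ ((Nat.choose_le_two_pow _ _).trans
          (Nat.pow_le_pow_right (by norm_num) (hQ m₀)))
      have h3 := ih (m₀ + 1)
      have h4 : 40 * (2 ^ (2 * m₀ + c) * supCount n k (S.card + (m₀ + 1) + q)) ≤
          2 ^ (2 * m₀ + c) * supCount n k (S.card + m₀ + q) := by
        have := forty_mul_supCount_le hk hn (S.card + m₀ + q)
        rw [show S.card + (m₀ + 1) + q = S.card + m₀ + q + 1 by omega, mul_left_comm]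
        exact Nat.mul_le_mul_left _ this
      rw [show 2 * (m₀ + 1) + c = 2 * m₀ + c + 2 by omega, pow_add, mul_right_comm] at h3
      omega
  refine le_trans (Nat.mul_le_mul_left _ (cnt_mono ?_)) (key (k + 1) m₀)
  rintro A hA ⟨hS, m, h1, h2⟩
  have := Finset.card_le_card (Finset.inter_subset_left : A ∩ Q m ⊆ A)
  rw [hF A hA] at this
  exact ⟨hS, m, h1, by omega, h2⟩

theorem cnt_superset_inter_le_of_card_le (hF : ∀ A ∈ F, A.card = k) {S Q : Finset (Fin n)}
    (hSQ : Disjoint S Q) {s d C r : ℕ} (hQ : Q.card ≤ d) (hC : d.choose s = C)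
    (hr : S.card + s = r) :
    cnt F (fun A => S ⊆ A ∧ s ≤ (A ∩ Q).card) ≤ C * supCount n k r := by
  subst hC hr
  exact (cnt_superset_inter_le hF hSQ s).trans
    (Nat.mul_le_mul_right _ (Nat.choose_le_choose s hQ))

theorem cnt_exists_inter_le_of_eq (hk : 1 ≤ k) (hn : 40 * k ≤ n) (hF : ∀ A ∈ F, A.card = k)
    {S : Finset (Fin n)} {Q : ℕ → Finset (Fin n)} (hSQ : ∀ m, Disjoint S (Q m)) {c : ℕ}
    (hQ : ∀ m, (Q m).card ≤ 2 * m + c) (q m₀ : ℕ) {C r : ℕ} (hC : 10 * 2 ^ (2 * m₀ + c) = C)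
    (hr : S.card + m₀ + q = r) :
    9 * cnt F (fun A => S ⊆ A ∧ ∃ m ≥ m₀, m + q ≤ (A ∩ Q m).card) ≤ C * supCount n k r := by
  subst hC hr
  rw [mul_assoc]
  exact cnt_exists_inter_le hk hn hF hSQ hQ q m₀

end SupersetCounts

/-! ### Sets with a majority on an initial segment -/

section Dense

/-- The set `A` has a majority among the first `2m + 1` elements of `V`, for some `m`. -/
def PrefixDense {α : Type*} [LinearOrder α] (V A : Finset α) : Prop :=
  ∃ m, m + 1 ≤ (A ∩ smallest V (2 * m + 1)).card

theorem card_inter_smallest_mono {α : Type*} [LinearOrder α] (V A : Finset α) {s t : ℕ}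
    (h : s ≤ t) : (A ∩ smallest V s).card ≤ (A ∩ smallest V t).card :=
  Finset.card_le_card (Finset.inter_subset_inter_left (smallest_mono V h))

theorem card_inter_smallest_le {α : Type*} [LinearOrder α] (V A : Finset α) (t : ℕ) :
    (A ∩ smallest V t).card ≤ t :=
  (Finset.card_le_card Finset.inter_subset_right).trans (card_smallest_le V t)

/-- If A and B both fail, each has at most m of the first 2m + 1 points. With m = ⌊t/2⌋ the two
counts sum to at most t for every t, against the walk lemma. -/
theorem prefixDense_or {α : Type*} [LinearOrder α] {V : Finset α} {𝒜 ℬ : Finset α → Prop}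
    (hstab : ∀ A, 𝒜 A → ∀ i ∈ V, ∀ j ∈ V, i < j → i ∉ A → j ∈ A → 𝒜 (insert i (A.erase j)))
    (hcross : ∀ A, 𝒜 A → ∀ B, ℬ B → (A ∩ B ∩ V).Nonempty) :
    (∀ A, 𝒜 A → PrefixDense V A) ∨ (∀ B, ℬ B → PrefixDense V B) := by
  by_contra hcon
  push Not at hcon
  obtain ⟨⟨A, hA, hA'⟩, B, hB, hB'⟩ := hcon
  obtain ⟨t, ht⟩ := exists_lt_card_inter_smallest hstab hcross hA hB
  unfold PrefixDense at hA' hB'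
  push Not at hA' hB'
  have h1 := hA' (t / 2)
  have h2 := hB' (t / 2)
  have h3 := card_inter_smallest_mono V A (show t ≤ 2 * (t / 2) + 1 by omega)
  have h4 := card_inter_smallest_mono V B (show t ≤ 2 * (t / 2) + 1 by omega)
  omega

theorem card_inter_smallest_of_inter_one_eq_empty {α : Type*} [LinearOrder α] {V A : Finset α}
    (h : A ∩ smallest V 1 = ∅) (t : ℕ) :
    A ∩ (smallest V t \ smallest V 1) = A ∩ smallest V t := by
  ext z
  simp only [Finset.mem_inter, Finset.mem_sdiff]
  constructor
  · exact fun h' => ⟨h'.1, h'.2.1⟩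
  · exact fun h' => ⟨h'.1, h'.2, fun h1 =>
      absurd (Finset.mem_inter.2 ⟨h'.1, h1⟩) (h ▸ Finset.notMem_empty z)⟩

theorem PrefixDense.cases {α : Type*} [LinearOrder α] {V A : Finset α} (h : PrefixDense V A) :
    (A ∩ smallest V 1).Nonempty ∨ 2 ≤ (A ∩ (smallest V 3 \ smallest V 1)).card ∨
      ∃ m ≥ 2, m + 1 ≤ (A ∩ (smallest V (2 * m + 1) \ smallest V 1)).card := by
  obtain ⟨m, hm⟩ := h
  rcases (A ∩ smallest V 1).eq_empty_or_nonempty with h0 | h0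
  · rw [← card_inter_smallest_of_inter_one_eq_empty h0] at hm
    obtain rfl | rfl | h2 : m = 0 ∨ m = 1 ∨ 2 ≤ m := by omega
    · simp at hm
    · exact Or.inr (Or.inl hm)
    · exact Or.inr (Or.inr ⟨m, h2, hm⟩)
  · exact Or.inl h0

variable {n k : ℕ} {F : Finset (Finset (Fin n))}

theorem cnt_dense_tail_le (hk : 1 ≤ k) (hn : 40 * k ≤ n) (hF : ∀ A ∈ F, A.card = k)
    {S V : Finset (Fin n)} (hSV : Disjoint S V) :
    9 * cnt F (fun A => S ⊆ A ∧ ∃ m ≥ 2,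
      m + 1 ≤ (A ∩ (smallest V (2 * m + 1) \ smallest V 1)).card) ≤
      160 * supCount n k (S.card + 3) := by
  exact cnt_exists_inter_le_of_eq hk hn hF (S := S)
    (Q := fun m => smallest V (2 * m + 1) \ smallest V 1) (c := 0)
    (fun m => hSV.mono_right (Finset.sdiff_subset.trans (smallest_subset V _)))
    (fun m => card_smallest_sdiff_one_le V m) 1 2 (by norm_num) (by omega)

theorem cnt_pair_le (hF : ∀ A ∈ F, A.card = k) {S V : Finset (Fin n)} (hSV : Disjoint S V) :
    cnt F (fun A => S ⊆ A ∧ 2 ≤ (A ∩ (smallest V 3 \ smallest V 1)).card) ≤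
      supCount n k (S.card + 2) := by
  have := cnt_superset_inter_le_of_card_le hF (s := 2)
    (hSV.mono_right (Finset.sdiff_subset.trans (smallest_subset V _)))
    (card_smallest_sdiff_one_le V 1) (Nat.choose_self 2) rfl
  rwa [one_mul] at this

/-- Beyond the sets through the first point, the second and third points give one term at |S| + 2,
and the tail gives 160/9 terms at |S| + 3, at most 160/360 of one term. -/
theorem cnt_dense_le (hk : 1 ≤ k) (hn : 40 * k ≤ n) (hF : ∀ A ∈ F, A.card = k)
    {S V : Finset (Fin n)} (hSV : Disjoint S V) :
    cnt F (fun A => S ⊆ A ∧ PrefixDense V A) ≤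
      cnt F (fun A => S ⊆ A ∧ (A ∩ smallest V 1).Nonempty) + 2 * supCount n k (S.card + 2) := by
  have h1 := cnt_dense_tail_le hk hn hF hSV
  have h2 := cnt_pair_le hF hSV
  have h3 := forty_mul_supCount_le hk hn (S.card + 2)
  have h4 : cnt F (fun A => S ⊆ A ∧ PrefixDense V A) ≤ _ := cnt_le_add_add
    (q := fun A => S ⊆ A ∧ (A ∩ smallest V 1).Nonempty)
    (s := fun A => S ⊆ A ∧ 2 ≤ (A ∩ (smallest V 3 \ smallest V 1)).card)
    (t := fun A => S ⊆ A ∧ ∃ m ≥ 2,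
      m + 1 ≤ (A ∩ (smallest V (2 * m + 1) \ smallest V 1)).card) (fun A _ hA => by
      rcases hA.2.cases with h | h | h
      · exact Or.inl ⟨hA.1, h⟩
      · exact Or.inr (Or.inl ⟨hA.1, h⟩)
      · exact Or.inr (Or.inr ⟨hA.1, h⟩))
  rw [show S.card + 2 + 1 = S.card + 3 by omega] at h3
  omega

/-- Three of four points (m = 2) give 4U; the range m ≥ 3 adds at most 640/360 U. -/
theorem cnt_dense_tail_le_six_mul (hk : 1 ≤ k) (hn : 40 * k ≤ n) (hF : ∀ A ∈ F, A.card = k)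
    (V : Finset (Fin n)) :
    cnt F (fun A => ∃ m ≥ 2,
      m + 1 ≤ (A ∩ (smallest V (2 * m + 1) \ smallest V 1)).card) ≤ 6 * supCount n k 3 := by
  have h1 := cnt_exists_inter_le_of_eq hk hn hF (S := ∅)
    (Q := fun m => smallest V (2 * m + 1) \ smallest V 1) (c := 0)
    (fun m => Finset.disjoint_empty_left _) (fun m => card_smallest_sdiff_one_le V m) 1 3
    (C := 640) (r := 4) (by norm_num) (by simp)
  have h2 := cnt_superset_inter_le_of_card_le hF (s := 3) (C := 4) (r := 3)
    (Finset.disjoint_empty_left (smallest V 5 \ smallest V 1))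
    (card_smallest_sdiff_one_le V 2) (by decide) (by simp)
  have h4 : 40 * supCount n k 4 ≤ _ := forty_mul_supCount_le hk hn 3
  have h5 : cnt F (fun A => ∃ m ≥ 2,
      m + 1 ≤ (A ∩ (smallest V (2 * m + 1) \ smallest V 1)).card) ≤ _ := cnt_le_add
    (q := fun A => ∅ ⊆ A ∧ 3 ≤ (A ∩ (smallest V 5 \ smallest V 1)).card)
    (s := fun A => ∅ ⊆ A ∧ ∃ m ≥ 3,
      m + 1 ≤ (A ∩ (smallest V (2 * m + 1) \ smallest V 1)).card) (fun A _ hA => by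
      obtain ⟨m, hm, hA⟩ := hA
      rcases hm.eq_or_lt with rfl | h
      · exact Or.inl ⟨Finset.empty_subset _, hA⟩
      · exact Or.inr ⟨Finset.empty_subset _, m, h, hA⟩)
  omega

end Dense

/-! ### Consequences of a pair of large degree -/

section HeavyPairs

variable {n k : ℕ} {F : Finset (Finset (Fin n))}

theorem exists_shiftStable (V : Finset (Fin n)) (hF : ∀ A ∈ F, A.card = k) (hm : Meets F) :
    ∃ G : Finset (Finset (Fin n)), (∀ A ∈ G, A.card = k) ∧ Meets G ∧ ShiftStable V G ∧
      ∀ p : Finset (Fin n) → Prop, (∀ i ∈ V, ∀ j ∈ V, i < j → SwapInvariant i j p) →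
        cnt G p = cnt F p := by
  obtain ⟨G, ⟨h1, h2, h3⟩, h4⟩ := exists_shift_minimal V
    (fun G => (∀ A ∈ G, A.card = k) ∧ Meets G ∧
      ∀ p : Finset (Fin n) → Prop, (∀ i ∈ V, ∀ j ∈ V, i < j → SwapInvariant i j p) →
        cnt G p = cnt F p) (F₀ := F) ⟨hF, hm, fun _ _ => rfl⟩
  refine ⟨G, h1, h2, fun i hi j hj hij => (h4 i hi j hj hij).resolve_right fun h => h ?_, h3⟩
  exact ⟨shiftFam_card_eq i j h1, h2.shiftFam hij.ne, fun p hp =>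
    (cnt_shiftFam hij.ne G (hp i hi j hj hij)).trans (h3 p hp)⟩

theorem swapInvariant_mem {V : Finset (Fin n)} {x i j : Fin n} (hx : x ∉ V) (hi : i ∈ V)
    (hj : j ∈ V) : SwapInvariant i j (fun A => x ∈ A) :=
  swapInvariant_of_notMem (fun h => hx (h ▸ hi)) (fun h => hx (h ▸ hj))

/-- If a pair of points has large degree, few members avoid both. -/
theorem cnt_avoid_pair_le (hk : 1 ≤ k) (hn : 40 * k ≤ n) (hF : ∀ A ∈ F, A.card = k)
    (hm : Meets F) {a b : Fin n} (hab : a ≠ b) (hU : 0 < supCount n k 3)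
    (h : 5 * supCount n k 3 ≤ 2 * cnt F (fun A => a ∈ A ∧ b ∈ A)) :
    cnt F (fun A => a ∉ A ∧ b ∉ A) ≤ 2 * supCount n k 3 := by
  set V : Finset (Fin n) := {a, b}ᶜ with hV
  have haV : a ∉ V := by simp [hV]
  have hbV : b ∉ V := by simp [hV]
  obtain ⟨G, hG, hGm, hst, hcnt⟩ := exists_shiftStable V hF hm
  rw [← hcnt _ fun i hi j hj _ => (swapInvariant_mem haV hi hj).and
    (swapInvariant_mem hbV hi hj)] at h
  rw [← hcnt _ fun i hi j hj _ => (swapInvariant_mem haV hi hj).not.and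
    (swapInvariant_mem hbV hi hj).not]
  have h40 : 40 * supCount n k 4 ≤ _ := forty_mul_supCount_le hk hn 3
  -- The requirement is split unevenly so that each alternative yields a bound of order U. If both
  -- failed, the counts would sum to at most t for every t.
  have hwalk : (∀ A ∈ G, a ∈ A ∧ b ∈ A → ∃ m ≥ 1, m ≤ (A ∩ smallest V (2 * m)).card) ∨
      (∀ B ∈ G, a ∉ B ∧ b ∉ B → ∃ m ≥ 1, m + 2 ≤ (B ∩ smallest V (2 * m + 1)).card) := by
    by_contra hcon
    push Not at hcon
    obtain ⟨⟨A, hA, hA', hAm⟩, B, hB, hB', hBm⟩ := hcon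
    obtain ⟨t, ht⟩ := exists_lt_card_inter_smallest (V := V)
      (𝒜 := fun A => A ∈ G ∧ a ∈ A ∧ b ∈ A) (ℬ := fun B => B ∈ G ∧ a ∉ B ∧ b ∉ B)
      (fun A hA i hi j hj hij hiA hjA => ⟨hst.insert_erase_mem hi hj hij hA.1 hiA hjA,
        (swapInvariant_mem haV hi hj A hiA hjA).2 hA.2.1,
        (swapInvariant_mem hbV hi hj A hiA hjA).2 hA.2.2⟩)
      (fun A hA B hB => by
        obtain ⟨w, hw⟩ := hGm A hA.1 B hB.1
        refine ⟨w, Finset.mem_inter.2 ⟨hw, ?_⟩⟩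
        rw [Finset.mem_inter] at hw
        simp only [hV, Finset.mem_compl, Finset.mem_insert, Finset.mem_singleton, not_or]
        exact ⟨fun h => hB.2.1 (h ▸ hw.2), fun h => hB.2.2 (h ▸ hw.2)⟩)
      ⟨hA, hA'⟩ ⟨hB, hB'⟩
    have h1 := card_inter_smallest_le V A t
    have h2 := card_inter_smallest_le V B t
    have h3 := hAm ((t + 1) / 2)
    have h4 := hBm (t / 2)
    have h5 := card_inter_smallest_mono V A (show t ≤ 2 * ((t + 1) / 2) by omega)
    have h6 := card_inter_smallest_mono V B (show t ≤ 2 * (t / 2) + 1 by omega)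
    omega
  have hS : Disjoint ({a, b} : Finset (Fin n)) V := by
    rw [hV]; exact disjoint_compl_right
  have hScard : ({a, b} : Finset (Fin n)).card = 2 := Finset.card_pair hab
  rcases hwalk with hw | hw
  -- One of two points gives 2U and the tail at most 160/360 U, in total less than 5U/2.
  · exfalso
    have h1 := cnt_superset_inter_le_of_card_le hG (s := 1) (C := 2) (r := 3)
      (hS.mono_right (smallest_subset V 2)) (card_smallest_le V 2) rfl (by omega)
    have h2 := cnt_exists_inter_le_of_eq hk hn hG (S := {a, b})
      (Q := fun m => smallest V (2 * m)) (c := 0) (fun m => hS.mono_right (smallest_subset V _))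
      (fun m => card_smallest_le V _) 0 2 (C := 160) (r := 4) (by norm_num) (by omega)
    have h3 : cnt G (fun A => a ∈ A ∧ b ∈ A) ≤ _ := cnt_le_add
      (q := fun A => {a, b} ⊆ A ∧ 1 ≤ (A ∩ smallest V 2).card)
      (s := fun A => {a, b} ⊆ A ∧ ∃ m ≥ 2, m + 0 ≤ (A ∩ smallest V (2 * m)).card)
      (fun A hA hab => by
        have hs : ({a, b} : Finset (Fin n)) ⊆ A := by
          simp [Finset.insert_subset_iff, hab]
        obtain ⟨m, hm, hAm⟩ := hw A hA hab
        rcases hm.eq_or_lt with rfl | h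
        · exact Or.inl ⟨hs, hAm⟩
        · exact Or.inr ⟨hs, m, h, hAm⟩)
    omega
  -- Three of three points give U and the tail at most 320/360 U.
  · have h1 := cnt_superset_inter_le_of_card_le hG (s := 3) (C := 1) (r := 3)
      (Finset.disjoint_empty_left (smallest V 3)) (card_smallest_le V 3) rfl (by simp)
    have h2 := cnt_exists_inter_le_of_eq hk hn hG (S := ∅)
      (Q := fun m => smallest V (2 * m + 1)) (c := 1) (fun m => Finset.disjoint_empty_left _)
      (fun m => card_smallest_le V _) 2 2 (C := 320) (r := 4) (by norm_num) (by simp)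
    have h3 : cnt G (fun A => a ∉ A ∧ b ∉ A) ≤ _ := cnt_le_add
      (q := fun A => ∅ ⊆ A ∧ 3 ≤ (A ∩ smallest V 3).card)
      (s := fun A => ∅ ⊆ A ∧ ∃ m ≥ 2, m + 2 ≤ (A ∩ smallest V (2 * m + 1)).card)
      (fun A hA hab => by
        obtain ⟨m, hm, hAm⟩ := hw A hA hab
        rcases hm.eq_or_lt with rfl | h
        · exact Or.inl ⟨Finset.empty_subset _, hAm⟩
        · exact Or.inr ⟨Finset.empty_subset _, m, h, hAm⟩)
    omega

/-- In an intersecting family, if many members contain `y` but neither `x` nor `z`, then those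
containing `x` and `z` but not `y` are essentially no more than the sets through one more point. -/
theorem cnt_mem_mem_notMem_le (hk : 1 ≤ k) (hn : 40 * k ≤ n) (hF : ∀ A ∈ F, A.card = k)
    (hm : Meets F) {x y z : Fin n} (hxz : x ≠ z) (hU : 0 < supCount n k 3)
    (h : 2 * supCount n k 3 ≤ cnt F (fun A => y ∈ A ∧ x ∉ A ∧ z ∉ A)) :
    cnt F (fun A => x ∈ A ∧ z ∈ A ∧ y ∉ A) ≤ supCount n k 3 + 2 * supCount n k 4 := by
  set V : Finset (Fin n) := {x, y, z}ᶜ with hV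
  have hxV : x ∉ V := by simp [hV]
  have hyV : y ∉ V := by simp [hV]
  have hzV : z ∉ V := by simp [hV]
  obtain ⟨G, hG, hGm, hst, hcnt⟩ := exists_shiftStable V hF hm
  rw [← hcnt _ fun i hi j hj _ => (swapInvariant_mem hyV hi hj).and
    ((swapInvariant_mem hxV hi hj).not.and (swapInvariant_mem hzV hi hj).not)] at h
  rw [← hcnt _ fun i hi j hj _ => (swapInvariant_mem hxV hi hj).and
    ((swapInvariant_mem hzV hi hj).and (swapInvariant_mem hyV hi hj).not)]
  have h40 : 40 * supCount n k 4 ≤ _ := forty_mul_supCount_le hk hn 3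
  -- The first alternative leaves fewer than 2U sets through y, so the sets through x and z are the
  -- dense ones.
  have hwalk : (∀ A ∈ G, y ∈ A ∧ x ∉ A ∧ z ∉ A →
        ∃ m ≥ 1, m + 1 ≤ (A ∩ smallest V (2 * m)).card) ∨
      (∀ B ∈ G, x ∈ B ∧ z ∈ B ∧ y ∉ B → PrefixDense V B) := by
    by_contra hcon
    unfold PrefixDense at hcon
    push Not at hcon
    obtain ⟨⟨A, hA, hA', hAm⟩, B, hB, hB', hBm⟩ := hcon
    obtain ⟨t, ht⟩ := exists_lt_card_inter_smallest (V := V)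
      (𝒜 := fun A => A ∈ G ∧ y ∈ A ∧ x ∉ A ∧ z ∉ A) (ℬ := fun B => B ∈ G ∧ x ∈ B ∧ z ∈ B ∧ y ∉ B)
      (fun A hA i hi j hj hij hiA hjA => ⟨hst.insert_erase_mem hi hj hij hA.1 hiA hjA,
        (swapInvariant_mem hyV hi hj A hiA hjA).2 hA.2.1,
        mt (swapInvariant_mem hxV hi hj A hiA hjA).1 hA.2.2.1,
        mt (swapInvariant_mem hzV hi hj A hiA hjA).1 hA.2.2.2⟩)
      (fun A hA B hB => by
        obtain ⟨w, hw⟩ := hGm A hA.1 B hB.1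
        refine ⟨w, Finset.mem_inter.2 ⟨hw, ?_⟩⟩
        rw [Finset.mem_inter] at hw
        simp only [hV, Finset.mem_compl, Finset.mem_insert, Finset.mem_singleton, not_or]
        exact ⟨fun h => hA.2.2.1 (h ▸ hw.1), fun h => hB.2.2.2 (h ▸ hw.2),
          fun h => hA.2.2.2 (h ▸ hw.1)⟩)
      ⟨hA, hA'⟩ ⟨hB, hB'⟩
    have h1 := card_inter_smallest_le V A t
    have h3 := hAm ((t + 1) / 2)
    have h4 := hBm (t / 2)
    have h5 := card_inter_smallest_mono V A (show t ≤ 2 * ((t + 1) / 2) by omega)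
    have h6 := card_inter_smallest_mono V B (show t ≤ 2 * (t / 2) + 1 by omega)
    omega
  rcases hwalk with hw | hw
  · exfalso
    have hS : Disjoint ({y} : Finset (Fin n)) V := by simpa using hyV
    have h1 := cnt_superset_inter_le_of_card_le hG (s := 2) (C := 1) (r := 3)
      (hS.mono_right (smallest_subset V 2)) (card_smallest_le V 2) rfl (by simp)
    have h2 := cnt_exists_inter_le_of_eq hk hn hG (S := {y}) (Q := fun m => smallest V (2 * m))
      (c := 0) (fun m => hS.mono_right (smallest_subset V _)) (fun m => card_smallest_le V _) 1 2
      (C := 160) (r := 4) (by norm_num) (by simp)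
    have h3 : cnt G (fun A => y ∈ A ∧ x ∉ A ∧ z ∉ A) ≤ _ := cnt_le_add
      (q := fun A => {y} ⊆ A ∧ 2 ≤ (A ∩ smallest V 2).card)
      (s := fun A => {y} ⊆ A ∧ ∃ m ≥ 2, m + 1 ≤ (A ∩ smallest V (2 * m)).card)
      (fun A hA hab => by
        have hs : ({y} : Finset (Fin n)) ⊆ A := by simpa using hab.1
        obtain ⟨m, hm, hAm⟩ := hw A hA hab
        rcases hm.eq_or_lt with rfl | h
        · exact Or.inl ⟨hs, hAm⟩
        · exact Or.inr ⟨hs, m, h, hAm⟩)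
    omega
  · have hS : Disjoint ({x, z} : Finset (Fin n)) V := by simp [hxV, hzV]
    have hScard : ({x, z} : Finset (Fin n)).card = 2 := Finset.card_pair hxz
    have h1 := cnt_dense_le hk hn hG hS
    have h2 : cnt G (fun A => x ∈ A ∧ z ∈ A ∧ y ∉ A) ≤
        cnt G (fun A => {x, z} ⊆ A ∧ PrefixDense V A) := cnt_mono fun A hA h =>
      ⟨by simp [Finset.insert_subset_iff, h], hw A hA h⟩
    have h3 : cnt G (fun A => {x, z} ⊆ A ∧ (A ∩ smallest V 1).Nonempty) ≤ supCount n k 3 := by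
      have h4 := cnt_superset_inter_le_of_card_le hG (s := 1) (C := 1) (r := 3)
        (hS.mono_right (smallest_subset V 1)) (card_smallest_le V 1) rfl (by omega)
      simpa only [Finset.one_le_card, one_mul] using h4
    rw [hScard, show 2 + 2 = 4 from rfl] at h1
    omega

end HeavyPairs

/-! ### Effect of a shift on pair degrees -/

section PairDegrees

variable {α : Type*} [DecidableEq α]

theorem SwapInvariant.iff {i j : α} {p q : Finset α → Prop} (hp : SwapInvariant i j p)
    (hq : SwapInvariant i j q) : SwapInvariant i j (fun A => p A ↔ q A) :=
  fun A hi hj => iff_congr (hp A hi hj) (hq A hi hj)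

/-- Sets created by the shift lack j. -/
theorem cnt_shiftFam_le_of_mem {i j : α} (hij : i ≠ j) (F : Finset (Finset α))
    {p : Finset α → Prop} (hp : ∀ A, p A → j ∈ A) : cnt (shiftFam i j F) p ≤ cnt F p := by
  classical
  refine Finset.card_le_card fun A hA => ?_
  rw [Finset.mem_filter] at hA ⊢
  rcases mem_shiftFam_cases hij hA.1 with h | h
  · exact ⟨h.1, hA.2⟩
  · exact absurd (hp A hA.2) h.2.2.1

theorem cnt_mem_shiftFam_le {i j : α} (hij : i ≠ j) (F : Finset (Finset α)) :
    cnt (shiftFam i j F) (fun A => i ∈ A) ≤ cnt F (fun A => i ∈ A ∨ j ∈ A) := by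
  rw [← cnt_shiftFam hij F (swapInvariant_or i j)]
  exact cnt_mono fun A _ h => Or.inl h

theorem cnt_pair_shiftFam_le {i j y : α} (hij : i ≠ j) (hi : y ≠ i) (hj : y ≠ j)
    (F : Finset (Finset α)) :
    cnt (shiftFam i j F) (fun A => i ∈ A ∧ y ∈ A) ≤
      cnt F (fun A => i ∈ A ∧ y ∈ A) + cnt F (fun A => j ∈ A ∧ y ∈ A) := by
  have h1 := cnt_shiftFam hij F ((swapInvariant_or i j).and (swapInvariant_of_notMem hi hj))
  have h2 : cnt (shiftFam i j F) (fun A => i ∈ A ∧ y ∈ A) ≤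
      cnt (shiftFam i j F) (fun A => (i ∈ A ∨ j ∈ A) ∧ y ∈ A) :=
    cnt_mono fun A _ h => ⟨Or.inl h.1, h.2⟩
  have h3 : cnt F (fun A => (i ∈ A ∨ j ∈ A) ∧ y ∈ A) ≤ _ := cnt_le_add
    (q := fun A => i ∈ A ∧ y ∈ A) (s := fun A => j ∈ A ∧ y ∈ A) (fun A _ h => by tauto)
  omega

theorem cnt_pair_comm {α : Type*} (F : Finset (Finset α)) (a b : α) :
    cnt F (fun A => a ∈ A ∧ b ∈ A) = cnt F (fun A => b ∈ A ∧ a ∈ A) :=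
  cnt_congr fun _ _ => and_comm

/-- If a shift makes a pair degree reach `c`, then some pair degree was at least `c / 2`. -/
theorem exists_pair_of_shiftFam {i j a b : α} (hij : i ≠ j) (hab : a ≠ b) {F : Finset (Finset α)} {c : ℕ}
    (h1 : cnt F (fun A => a ∈ A ∧ b ∈ A) < c)
    (h2 : c ≤ cnt (shiftFam i j F) (fun A => a ∈ A ∧ b ∈ A)) :
    ∃ y, (a = i ∧ b = y ∨ a = y ∧ b = i) ∧ ∃ e, (e = i ∨ e = j) ∧ y ≠ e ∧
      c ≤ 2 * cnt F (fun A => e ∈ A ∧ y ∈ A) := by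
  have key : ∀ y, y ≠ i → y ≠ j → c ≤ cnt (shiftFam i j F) (fun A => i ∈ A ∧ y ∈ A) →
      ∃ e, (e = i ∨ e = j) ∧ y ≠ e ∧ c ≤ 2 * cnt F (fun A => e ∈ A ∧ y ∈ A) := by
    intro y hi hj h
    have := cnt_pair_shiftFam_le hij hi hj F
    by_cases h' : c ≤ 2 * cnt F (fun A => i ∈ A ∧ y ∈ A)
    · exact ⟨i, Or.inl rfl, hi, h'⟩
    · exact ⟨j, Or.inr rfl, hj, by omega⟩
  by_cases haj : a = j
  · have := cnt_shiftFam_le_of_mem hij F (p := fun A => a ∈ A ∧ b ∈ A) (fun A h => haj ▸ h.1)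
    omega
  by_cases hbj : b = j
  · have := cnt_shiftFam_le_of_mem hij F (p := fun A => a ∈ A ∧ b ∈ A) (fun A h => hbj ▸ h.2)
    omega
  by_cases hai : a = i
  · by_cases hbi : b = i
    · exact absurd (hai.trans hbi.symm) hab
    · subst hai
      obtain ⟨e, he⟩ := key b hbi hbj h2
      exact ⟨b, Or.inl ⟨rfl, rfl⟩, e, he⟩
  · by_cases hbi : b = i
    · subst hbi
      rw [cnt_pair_comm] at h2
      obtain ⟨e, he⟩ := key a hai haj h2
      exact ⟨a, Or.inr ⟨rfl, rfl⟩, e, he⟩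
    · rw [cnt_shiftFam hij F ((swapInvariant_of_notMem hai haj).and
        (swapInvariant_of_notMem hbi hbj))] at h2
      omega

end PairDegrees

/-! ### Existence of a heavy pair -/

section HeavyPairExists

variable {n k : ℕ} {F : Finset (Finset (Fin n))}

/-- All pair degrees of the family are below `c`. -/
def PairDegreesLT (c : ℕ) (F : Finset (Finset (Fin n))) : Prop :=
  ∀ a b, a ≠ b → cnt F (fun A => a ∈ A ∧ b ∈ A) < c

theorem exists_pair_of_not_pairDegreesLT_shiftFam {c : ℕ} {i j : Fin n} (hij : i ≠ j)
    (hF : PairDegreesLT c F) (h : ¬ PairDegreesLT c (shiftFam i j F)) :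
    ∃ y e, (e = i ∨ e = j) ∧ y ≠ e ∧ c ≤ 2 * cnt F (fun A => e ∈ A ∧ y ∈ A) := by
  unfold PairDegreesLT at h
  push Not at h
  obtain ⟨a, b, hab, h⟩ := h
  obtain ⟨y, -, e, he⟩ := exists_pair_of_shiftFam hij hab (hF a b hab) h
  exact ⟨y, e, he⟩

/-- The two halves of a family separated by a pair of points cannot both be large if all pair
degrees are small. -/
theorem PairDegreesLT.not_both_large (hk : 1 ≤ k) (hn : 40 * k ≤ n) (hU : 0 < supCount n k 3)
    (hF : ∀ A ∈ F, A.card = k) (hm : Meets F) (hlt : PairDegreesLT (5 * supCount n k 3) F)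
    {x y : Fin n} (hxy : x ≠ y) (hx : 7 * supCount n k 3 ≤ cnt F (fun A => x ∈ A ∧ y ∉ A)) :
    cnt F (fun A => x ∉ A ∧ y ∈ A) < 7 * supCount n k 3 := by
  classical
  by_contra! hy
  set U := supCount n k 3 with hUdef
  set V : Finset (Fin n) := {x, y}ᶜ with hV
  have hxV : x ∉ V := by simp [hV]
  have hyV : y ∉ V := by simp [hV]
  have hVx : ∀ z ∈ V, z ≠ x := fun z hz h => hxV (h ▸ hz)
  have hVy : ∀ z ∈ V, z ≠ y := fun z hz h => hyV (h ▸ hz)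
  have hVcard : 1 ≤ V.card := by
    have h1 := Finset.card_add_card_compl ({x, y} : Finset (Fin n))
    rw [Finset.card_pair hxy, Fintype.card_fin, ← hV] at h1
    omega
  -- Keep the members containing exactly one of x, y, and shift outside {x, y} while the pair
  -- degrees with x and with y stay below 5U.
  obtain ⟨G, ⟨hG, hGm, hsep, hGx, hGy, hGxz, hGyz⟩, hmin⟩ := exists_shift_minimal V
    (fun G => (∀ A ∈ G, A.card = k) ∧ Meets G ∧ cnt G (fun A => ¬ (x ∈ A ↔ y ∉ A)) = 0 ∧
      7 * U ≤ cnt G (fun A => x ∈ A) ∧ 7 * U ≤ cnt G (fun A => y ∈ A) ∧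
      (∀ z ∈ V, cnt G (fun A => z ∈ A ∧ x ∈ A) < 5 * U) ∧
      ∀ z ∈ V, cnt G (fun A => z ∈ A ∧ y ∈ A) < 5 * U)
    (F₀ := F.filter fun A => x ∈ A ↔ y ∉ A)
    ⟨fun A hA => hF A (Finset.filter_subset _ _ hA), hm.subset (Finset.filter_subset _ _),
      cnt_eq_zero fun A hA => not_not.2 (Finset.mem_filter.1 hA).2,
      hx.trans (by rw [cnt_filter]; exact cnt_mono fun A _ h => by tauto),
      hy.trans (by rw [cnt_filter]; exact cnt_mono fun A _ h => by tauto),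
      fun z hz => (cnt_subset (Finset.filter_subset _ _)).trans_lt (hlt z x (hVx z hz)),
      fun z hz => (cnt_subset (Finset.filter_subset _ _)).trans_lt (hlt z y (hVy z hz))⟩
  have hsep' : ∀ A ∈ G, x ∈ A ↔ y ∉ A := by
    intro A hA
    by_contra hc
    have h1 : 0 < cnt G (fun A => ¬ (x ∈ A ↔ y ∉ A)) :=
      cnt_pos hA hc
    omega
  -- At most 2U members would avoid both e and x. Members through y avoid x, so they would number
  -- less than 5U + 2U.
  have hnx : ∀ e ∈ V, 5 * U ≤ 2 * cnt G (fun A => e ∈ A ∧ x ∈ A) → False := by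
    intro e he h
    have h1 := cnt_avoid_pair_le hk hn hG hGm (hVx e he) hU h
    have h2 : cnt G (fun A => y ∈ A) ≤ _ := cnt_le_add
      (q := fun A => e ∈ A ∧ y ∈ A) (s := fun A => e ∉ A ∧ x ∉ A)
      (fun A hA h => by have := hsep' A hA; tauto)
    have h3 := hGyz e he
    omega
  have hny : ∀ e ∈ V, 5 * U ≤ 2 * cnt G (fun A => e ∈ A ∧ y ∈ A) → False := by
    intro e he h
    have h1 := cnt_avoid_pair_le hk hn hG hGm (hVy e he) hU h
    have h2 : cnt G (fun A => x ∈ A) ≤ _ := cnt_le_add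
      (q := fun A => e ∈ A ∧ x ∈ A) (s := fun A => e ∉ A ∧ y ∉ A)
      (fun A hA h => by have := hsep' A hA; tauto)
    have h3 := hGxz e he
    omega
  have hst : ShiftStable V G := by
    intro i hi j hj hij
    refine (hmin i hi j hj hij).resolve_right fun hcon => hcon ?_
    have hpair : ∀ w, w ∉ V → (∀ z ∈ V, z ≠ w) →
        (∀ z ∈ V, cnt G (fun A => z ∈ A ∧ w ∈ A) < 5 * U) →
        (∀ e ∈ V, 5 * U ≤ 2 * cnt G (fun A => e ∈ A ∧ w ∈ A) → False) →
        ∀ z ∈ V, cnt (shiftFam i j G) (fun A => z ∈ A ∧ w ∈ A) < 5 * U := by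
      intro w hw hne hlt hno z hz
      by_contra! hc
      obtain ⟨u, hu, e, he, -, h⟩ := exists_pair_of_shiftFam hij.ne (hne z hz) (hlt z hz) hc
      have hwu : w = u := by
        rcases hu with h | h
        · exact h.2
        · exact absurd (h.2 ▸ hi) hw
      subst hwu
      exact hno e (by rcases he with rfl | rfl <;> assumption) h
    refine ⟨shiftFam_card_eq i j hG, hGm.shiftFam hij.ne, ?_, ?_, ?_,
      hpair x hxV hVx hGxz hnx, hpair y hyV hVy hGyz hny⟩
    · rw [cnt_shiftFam hij.ne G ((swapInvariant_mem hxV hi hj).iff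
        (swapInvariant_mem hyV hi hj).not).not]
      exact hsep
    · rwa [cnt_shiftFam hij.ne G (swapInvariant_mem hxV hi hj)]
    · rwa [cnt_shiftFam hij.ne G (swapInvariant_mem hyV hi hj)]
  obtain ⟨v, hv, hv1⟩ := exists_smallest_one_eq V hVcard
  -- Dense sets through w number at most the degree of {v, w} plus 2U, hence less than 7U.
  have hend : ∀ w, w ∉ V → 7 * U ≤ cnt G (fun A => w ∈ A) →
      cnt G (fun A => v ∈ A ∧ w ∈ A) < 5 * U → ¬ ∀ A, A ∈ G ∧ w ∈ A → PrefixDense V A := by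
    intro w hw h7 h5 hd
    have h1 := cnt_dense_le hk hn hG (Finset.disjoint_singleton_left.2 hw)
    rw [Finset.card_singleton, show 1 + 2 = 3 from rfl, hv1, ← hUdef] at h1
    have h2 : cnt G (fun A => w ∈ A) ≤ cnt G (fun A => {w} ⊆ A ∧ PrefixDense V A) :=
      cnt_mono fun A hA h => ⟨Finset.singleton_subset_iff.2 h, hd A ⟨hA, h⟩⟩
    have h3 : cnt G (fun A => {w} ⊆ A ∧ (A ∩ {v}).Nonempty) ≤
        cnt G (fun A => v ∈ A ∧ w ∈ A) := cnt_mono fun A hA h => by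
      obtain ⟨u, hu⟩ := h.2
      rw [Finset.mem_inter, Finset.mem_singleton] at hu
      exact ⟨hu.2 ▸ hu.1, Finset.singleton_subset_iff.1 h.1⟩
    omega
  rcases prefixDense_or (V := V) (𝒜 := fun A => A ∈ G ∧ x ∈ A) (ℬ := fun A => A ∈ G ∧ y ∈ A)
    (fun A hA i hi j hj hij hiA hjA => ⟨hst.insert_erase_mem hi hj hij hA.1 hiA hjA,
      (swapInvariant_mem hxV hi hj A hiA hjA).2 hA.2⟩)
    (fun A hA B hB => by
      obtain ⟨w, hw⟩ := hGm A hA.1 B hB.1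
      refine ⟨w, Finset.mem_inter.2 ⟨hw, ?_⟩⟩
      rw [Finset.mem_inter] at hw
      simp only [hV, Finset.mem_compl, Finset.mem_insert, Finset.mem_singleton, not_or]
      have h1 := hsep' A hA.1
      have h2 := hsep' B hB.1
      constructor
      · rintro rfl
        tauto
      · rintro rfl
        tauto) with h | h
  · exact hend x hxV hGx (hGxz v hv) h
  · exact hend y hyV hGy (hGyz v hv) h

/-- If all pair degrees are small, then every point has small degree or small codegree. -/
theorem PairDegreesLT.cnt_mem_lt (hk : 1 ≤ k) (hn : 40 * k ≤ n) (hU : 0 < supCount n k 3)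
    (hF : ∀ A ∈ F, A.card = k) (hm : Meets F) (hlt : PairDegreesLT (5 * supCount n k 3) F)
    {x : Fin n} (hx : 18 * supCount n k 3 ≤ cnt F (fun A => x ∉ A)) :
    cnt F (fun A => x ∈ A) < 12 * supCount n k 3 := by
  by_contra! hx'
  set U := supCount n k 3 with hUdef
  set V : Finset (Fin n) := {x}ᶜ with hV
  have hxV : x ∉ V := by simp [hV]
  have hVx : ∀ z ∈ V, z ≠ x := fun z hz h => hxV (h ▸ hz)
  have hVcard : 3 ≤ V.card := by
    have h1 := Finset.card_add_card_compl ({x} : Finset (Fin n))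
    rw [Finset.card_singleton, Fintype.card_fin, ← hV] at h1
    omega
  obtain ⟨G, ⟨hG, hGm, hGlt, hGx, hGx'⟩, hmin⟩ := exists_shift_minimal V
    (fun G => (∀ A ∈ G, A.card = k) ∧ Meets G ∧ PairDegreesLT (5 * U) G ∧
      18 * U ≤ cnt G (fun A => x ∉ A) ∧ 12 * U ≤ cnt G (fun A => x ∈ A)) ⟨hF, hm, hlt, hx, hx'⟩
  -- Otherwise fewer than 7U members contain x but not v and fewer than 5U contain both, against
  -- degree 12U of x.
  have hmain : ∀ v, v ≠ x → 7 * U ≤ cnt G (fun A => v ∈ A ∧ x ∉ A) → False := by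
    intro v hv h
    have h1 := hGlt.not_both_large hk hn hU hG hGm hv h
    have h2 : cnt G (fun A => x ∈ A) ≤ _ := cnt_le_add
      (q := fun A => v ∈ A ∧ x ∈ A) (s := fun A => v ∉ A ∧ x ∈ A) (fun A _ h => by tauto)
    have h3 := hGlt v x hv
    omega
  have hst : ShiftStable V G := by
    intro i hi j hj hij
    refine (hmin i hi j hj hij).resolve_right fun hcon => hcon ?_
    refine ⟨shiftFam_card_eq i j hG, hGm.shiftFam hij.ne, ?_, ?_, ?_⟩
    -- The revealed pair {e, y} is avoided by at most 2U members. If y = x, at least 16U members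
    -- contain e but not x; otherwise x has degree below 5U + 5U + 2U.
    · by_contra hc
      obtain ⟨y, e, he, hne, h⟩ :=
        exists_pair_of_not_pairDegreesLT_shiftFam hij.ne hGlt hc
      have heV : e ∈ V := by rcases he with rfl | rfl <;> assumption
      have h1 := cnt_avoid_pair_le hk hn hG hGm hne.symm hU h
      by_cases hyx : y = x
      · subst hyx
        refine hmain e hne.symm ?_
        have h2 : cnt G (fun A => y ∉ A) ≤ _ := cnt_le_add
          (q := fun A => e ∈ A ∧ y ∉ A) (s := fun A => e ∉ A ∧ y ∉ A) (fun A _ h => by tauto)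
        omega
      · have h2 : cnt G (fun A => x ∈ A) ≤ _ := cnt_le_add_add
          (q := fun A => e ∈ A ∧ x ∈ A) (s := fun A => y ∈ A ∧ x ∈ A)
          (t := fun A => e ∉ A ∧ y ∉ A) (fun A _ h => by tauto)
        have h3 := hGlt e x (hVx e heV)
        have h4 := hGlt y x hyx
        omega
    · rwa [cnt_shiftFam hij.ne G (swapInvariant_mem hxV hi hj).not]
    · rwa [cnt_shiftFam hij.ne G (swapInvariant_mem hxV hi hj)]
  have hd : ∀ A, A ∈ G ∧ x ∉ A → PrefixDense V A := by
    have := prefixDense_or (V := V) (𝒜 := fun A => A ∈ G ∧ x ∉ A) (ℬ := fun A => A ∈ G ∧ x ∉ A)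
      (fun A hA i hi j hj hij hiA hjA => ⟨hst.insert_erase_mem hi hj hij hA.1 hiA hjA,
        mt (swapInvariant_mem hxV hi hj A hiA hjA).1 hA.2⟩)
      (fun A hA B hB => by
        obtain ⟨w, hw⟩ := hGm A hA.1 B hB.1
        refine ⟨w, Finset.mem_inter.2 ⟨hw, ?_⟩⟩
        rw [Finset.mem_inter] at hw
        simp only [hV, Finset.mem_compl, Finset.mem_singleton]
        rintro rfl
        exact hA.2 hw.1)
    exact this.elim id id
  obtain ⟨v, hv, hv1⟩ := exists_smallest_one_eq V (by omega)
  obtain ⟨c, hc, d, hd', hcd, hpair⟩ := exists_smallest_three_sdiff_eq V hVcard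
  refine hmain v (hVx v hv) ?_
  -- Fewer than 5U members contain c and d, and the tail has at most 6U, so of the 18U members
  -- missing x at least 7U contain v.
  have h1 : cnt G (fun A => x ∉ A) ≤ _ := cnt_le_add_add
    (q := fun A => v ∈ A ∧ x ∉ A) (s := fun A => c ∈ A ∧ d ∈ A)
    (t := fun A => ∃ m ≥ 2, m + 1 ≤ (A ∩ (smallest V (2 * m + 1) \ smallest V 1)).card)
    (fun A hA hxA => by
      rcases (hd A ⟨hA, hxA⟩).cases with ⟨w, hw⟩ | h | h
      · rw [hv1, Finset.mem_inter, Finset.mem_singleton] at hw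
        exact Or.inl ⟨hw.2 ▸ hw.1, hxA⟩
      · refine Or.inr (Or.inl ?_)
        rw [hpair] at h
        have h2 : A ∩ {c, d} = {c, d} :=
          Finset.eq_of_subset_of_card_le Finset.inter_subset_right
            (by rw [Finset.card_pair hcd]; exact h)
        have h3 := Finset.inter_eq_right.1 h2
        exact ⟨h3 (by simp), h3 (by simp)⟩
      · exact Or.inr (Or.inr h))
  have h2 := cnt_dense_tail_le_six_mul hk hn hG V
  have h3 := hGlt c d hcd
  omega

/-- An intersecting family of large diversity has a pair of points of large degree. -/
theorem exists_heavy_pair (hk : 1 ≤ k) (hn : 40 * k ≤ n) (hU : 0 < supCount n k 3)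
    (hF : ∀ A ∈ F, A.card = k) (hm : Meets F)
    (hdiv : ∀ x, 39 * supCount n k 3 ≤ cnt F (fun A => x ∉ A)) :
    ∃ a b, a ≠ b ∧ 5 * supCount n k 3 ≤ cnt F (fun A => a ∈ A ∧ b ∈ A) := by
  by_contra! hlt
  replace hlt : PairDegreesLT (5 * supCount n k 3) F := hlt
  have hdeg : ∀ x, cnt F (fun A => x ∈ A) < 12 * supCount n k 3 := fun x =>
    hlt.cnt_mem_lt hk hn hU hF hm (le_trans (by omega) (hdiv x))
  have hcard : 39 * supCount n k 3 ≤ cnt F (fun _ => True) :=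
    (hdiv ⟨0, by omega⟩).trans (cnt_mono fun _ _ _ => trivial)
  set U := supCount n k 3 with hUdef
  obtain ⟨G, ⟨hG, hGm, hGlt, hGcard, hGdeg⟩, hmin⟩ := exists_shift_minimal Finset.univ
    (fun G => (∀ A ∈ G, A.card = k) ∧ Meets G ∧ PairDegreesLT (5 * U) G ∧
      39 * U ≤ cnt G (fun _ => True) ∧ ∀ x, cnt G (fun A => x ∈ A) < 12 * U)
    ⟨hF, hm, hlt, hcard, hdeg⟩
  have hst : ShiftStable Finset.univ G := by
    intro i hi j hj hij
    refine (hmin i hi j hj hij).resolve_right fun hcon => hcon ?_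
    have hcard' : 39 * U ≤ cnt (shiftFam i j G) (fun _ => True) := by
      rwa [cnt_shiftFam hij.ne G (fun _ _ _ => Iff.rfl)]
    -- Otherwise the family has size below 12U + 12U + 2U.
    have hlt' : PairDegreesLT (5 * U) (shiftFam i j G) := by
      by_contra hc
      obtain ⟨y, e, he, hne, h⟩ :=
        exists_pair_of_not_pairDegreesLT_shiftFam hij.ne hGlt hc
      have h1 := cnt_avoid_pair_le hk hn hG hGm hne.symm hU h
      have h2 : cnt G (fun _ => True) ≤ _ := cnt_le_add_add
        (q := fun A => e ∈ A) (s := fun A => y ∈ A)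
        (t := fun A => e ∉ A ∧ y ∉ A) (fun A _ h => by tauto)
      have h3 := hGdeg e
      have h4 := hGdeg y
      omega
    refine ⟨shiftFam_card_eq i j hG, hGm.shiftFam hij.ne, hlt', hcard', fun x => ?_⟩
    by_cases hxj : x = j
    · subst hxj
      exact (cnt_shiftFam_le_of_mem hij.ne G fun A h => h).trans_lt (hGdeg x)
    by_cases hxi : x = i
    · subst hxi
      -- One of the two differences between the stars of x and j is below 7U, so fewer than 19U
      -- members meet {x, j}; after the shift more than 20U still miss x.
      refine hlt'.cnt_mem_lt hk hn hU (shiftFam_card_eq x j hG) (hGm.shiftFam hij.ne) ?_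
      have h1 := cnt_mem_shiftFam_le hij.ne G
      have h2 : cnt (shiftFam x j G) (fun _ => True) ≤ _ := cnt_le_add
        (q := fun A => x ∈ A) (s := fun A => x ∉ A) (fun A _ _ => em _)
      have h3 : cnt G (fun A => x ∈ A ∨ j ∈ A) ≤ _ := cnt_le_add
        (q := fun A => x ∈ A) (s := fun A => x ∉ A ∧ j ∈ A) (fun A _ h => by tauto)
      have h4 : cnt G (fun A => x ∈ A ∨ j ∈ A) ≤ _ := cnt_le_add
        (q := fun A => j ∈ A) (s := fun A => x ∈ A ∧ j ∉ A) (fun A _ h => by tauto)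
      have h5 := hGdeg x
      have h6 := hGdeg j
      by_cases h7 : 7 * U ≤ cnt G (fun A => x ∈ A ∧ j ∉ A)
      · have h8 := hGlt.not_both_large hk hn hU hG hGm hij.ne h7
        omega
      · omega
    · rw [cnt_shiftFam hij.ne G (swapInvariant_of_notMem hxi hxj)]
      exact hGdeg x
  have hd : ∀ A, A ∈ G → PrefixDense Finset.univ A := by
    have := prefixDense_or (V := Finset.univ) (𝒜 := fun A => A ∈ G) (ℬ := fun A => A ∈ G)
      (fun A hA i hi j hj hij hiA hjA => hst.insert_erase_mem hi hj hij hA hiA hjA)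
      (fun A hA B hB => by
        rw [Finset.inter_univ]
        exact hGm A hA B hB)
    exact this.elim id id
  have hV : 3 ≤ (Finset.univ : Finset (Fin n)).card := by
    rw [Finset.card_univ, Fintype.card_fin]
    omega
  obtain ⟨v, hv, hv1⟩ := exists_smallest_one_eq (Finset.univ : Finset (Fin n)) (by omega)
  obtain ⟨c, hc, d, hd', hcd, hpair⟩ := exists_smallest_three_sdiff_eq Finset.univ hV
  -- The three terms sum to less than 12U + 5U + 6U, below 39U.
  have h1 : cnt G (fun _ => True) ≤ _ := cnt_le_add_add
    (q := fun A => v ∈ A) (s := fun A => c ∈ A ∧ d ∈ A)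
    (t := fun A => ∃ m ≥ 2, m + 1 ≤ (A ∩ (smallest Finset.univ (2 * m + 1) \
      smallest Finset.univ 1)).card)
    (fun A hA _ => by
      rcases (hd A hA).cases with ⟨w, hw⟩ | h | h
      · rw [hv1, Finset.mem_inter, Finset.mem_singleton] at hw
        exact Or.inl (hw.2 ▸ hw.1)
      · refine Or.inr (Or.inl ?_)
        rw [hpair] at h
        have h2 : A ∩ {c, d} = {c, d} :=
          Finset.eq_of_subset_of_card_le Finset.inter_subset_right
            (by rw [Finset.card_pair hcd]; exact h)
        have h3 := Finset.inter_eq_right.1 h2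
        exact ⟨h3 (by simp), h3 (by simp)⟩
      · exact Or.inr (Or.inr h))
  have h2 := cnt_dense_tail_le_six_mul hk hn hG Finset.univ
  have h3 := hGlt c d hcd
  have h4 := hGdeg v
  omega

end HeavyPairExists

/-! ### From a heavy pair to a triangle -/

section Triangle

variable {n k : ℕ} {F : Finset (Finset (Fin n))}

theorem cnt_pair_meeting_le (hF : ∀ A ∈ F, A.card = k) {a b : Fin n} (hab : a ≠ b)
    {T : Finset (Fin n)} (haT : a ∉ T) (hbT : b ∉ T) :
    cnt F (fun A => a ∈ A ∧ b ∈ A ∧ (A ∩ T).Nonempty) ≤ T.card * supCount n k 3 := by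
  have hS : Disjoint ({a, b} : Finset (Fin n)) T := by simp [haT, hbT]
  refine le_trans (cnt_mono fun A _ h => ?_) (cnt_superset_inter_le_of_card_le hF hS le_rfl
    (s := 1) (Nat.choose_one_right _) (by rw [Finset.card_pair hab]))
  exact ⟨by simp [Finset.insert_subset_iff, h.1, h.2.1], Finset.one_le_card.2 h.2.2⟩

/-- Each counted set meets B in one of its k - 1 points other than x. -/
theorem cnt_mem_mem_notMem_le_of_exists (hF : ∀ A ∈ F, A.card = k) (hm : Meets F) {x y z : Fin n}
    (hyz : y ≠ z) (h : ∃ B ∈ F, x ∈ B ∧ y ∉ B ∧ z ∉ B) :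
    cnt F (fun A => y ∈ A ∧ x ∉ A ∧ z ∈ A) ≤ (k - 1) * supCount n k 3 := by
  obtain ⟨B, hB, hx, hy, hz⟩ := h
  have h1 := cnt_pair_meeting_le hF hyz (T := B.erase x) (fun h => hy (Finset.mem_of_mem_erase h))
    (fun h => hz (Finset.mem_of_mem_erase h))
  rw [Finset.card_erase_of_mem hx, hF B hB] at h1
  refine le_trans (cnt_mono fun A hA h => ⟨h.1, h.2.2, ?_⟩) h1
  obtain ⟨w, hw⟩ := hm A hA B hB
  rw [Finset.mem_inter] at hw
  exact ⟨w, Finset.mem_inter.2 ⟨hw.1, Finset.mem_erase.2 ⟨fun h' => h.2.1 (h' ▸ hw.1), hw.2⟩⟩⟩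

/-- If every point is missed by many members and some pair has large degree, then the pair extends
to a triangle. -/
theorem exists_third_point (hk : 1 ≤ k) (hn : 40 * k ≤ n) (hU : 0 < supCount n k 3)
    (hU4 : (k - 1) * supCount n k 4 ≤ supCount n k 3)
    (hF : ∀ A ∈ F, A.card = k) (hm : Meets F)
    (hdiv : ∀ x, (k + 5) * supCount n k 3 ≤ cnt F (fun A => x ∉ A)) {x y : Fin n} (hxy : x ≠ y)
    (hpair : 5 * supCount n k 3 ≤ cnt F (fun A => x ∈ A ∧ y ∈ A)) :
    ∃ z, x ≠ z ∧ y ≠ z ∧ ∀ A ∈ F, x ∈ A ∧ y ∈ A ∨ x ∈ A ∧ z ∈ A ∨ y ∈ A ∧ z ∈ A := by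
  set U := supCount n k 3 with hUdef
  have hkU : (k - 1) * U + U = k * U := by
    rw [← Nat.succ_mul, Nat.succ_eq_add_one, Nat.sub_add_cancel hk]
  have h0 := cnt_avoid_pair_le hk hn hF hm hxy hU (by omega)
  simp only [add_mul] at hdiv
  have hA : k * U + 3 * U ≤ cnt F (fun A => y ∈ A ∧ x ∉ A) := by
    have h1 : cnt F (fun A => x ∉ A) ≤ _ := cnt_le_add
      (q := fun A => y ∈ A ∧ x ∉ A) (s := fun A => x ∉ A ∧ y ∉ A) (fun A _ h => by tauto)
    have h2 := hdiv x
    omega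
  have hB : k * U + 3 * U ≤ cnt F (fun A => x ∈ A ∧ y ∉ A) := by
    have h1 : cnt F (fun A => y ∉ A) ≤ _ := cnt_le_add
      (q := fun A => x ∈ A ∧ y ∉ A) (s := fun A => x ∉ A ∧ y ∉ A) (fun A _ h => by tauto)
    have h2 := hdiv y
    omega
  obtain ⟨z, hxz, hyz, hzA, hzB⟩ : ∃ z, x ≠ z ∧ y ≠ z ∧ (∀ A ∈ F, y ∈ A → x ∉ A → z ∈ A) ∧
      ∀ A ∈ F, x ∈ A → y ∉ A → z ∈ A := by
    by_contra! hcon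
    -- If all members with x but not y contain z, some member with y but not x misses z, and that
    -- bounds the whole first class by (k-1)U, below (k+3)U.
    have hdegA : ∀ z, x ≠ z → y ≠ z →
        cnt F (fun A => y ∈ A ∧ x ∉ A ∧ z ∈ A) ≤ (k - 1) * U := by
      intro z hxz hyz
      by_cases hst : ∃ B ∈ F, x ∈ B ∧ y ∉ B ∧ z ∉ B
      · exact cnt_mem_mem_notMem_le_of_exists hF hm hyz hst
      · exfalso
        push Not at hst
        have h1 := cnt_mem_mem_notMem_le_of_exists hF hm (x := y) (y := x) hxz (by
          by_contra! h
          obtain ⟨A, hA, h1, h2, h3⟩ := hcon z hxz hyz h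
          exact h3 (hst A hA h1 h2))
        rw [← hUdef] at h1
        have h2 : cnt F (fun A => x ∈ A ∧ y ∉ A) ≤ cnt F (fun A => x ∈ A ∧ y ∉ A ∧ z ∈ A) :=
          cnt_mono fun A hA h => ⟨h.1, h.2, hst A hA h.1 h.2⟩
        omega
    -- At least (k+3)U - (k-1)U members contain y but neither x nor z.
    have hdegB : ∀ z, x ≠ z → y ≠ z →
        cnt F (fun A => x ∈ A ∧ z ∈ A ∧ y ∉ A) ≤ U + 2 * supCount n k 4 := by
      intro z hxz hyz
      refine cnt_mem_mem_notMem_le hk hn hF hm hxz hU ?_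
      have h1 := hdegA z hxz hyz
      have h2 : cnt F (fun A => y ∈ A ∧ x ∉ A) ≤ _ := cnt_le_add
        (q := fun A => y ∈ A ∧ x ∉ A ∧ z ∉ A) (s := fun A => y ∈ A ∧ x ∉ A ∧ z ∈ A)
        (fun A _ h => by tauto)
      omega
    -- Members with x but not y meet A outside y, so they number at most (k-1)(U + 2 `supCount n k
    -- 4`) ≤ (k+1)U, a contradiction.
    obtain ⟨A, hAF, hyA, hxA⟩ := exists_of_cnt_pos (show 0 < cnt F (fun A => y ∈ A ∧ x ∉ A) by omega)
    have h1 : cnt F (fun B => x ∈ B ∧ y ∉ B) ≤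
        ∑ z ∈ A.erase y, cnt F (fun B => x ∈ B ∧ z ∈ B ∧ y ∉ B) := by
      refine cnt_le_sum _ _ fun B hB h => ?_
      obtain ⟨w, hw⟩ := hm A hAF B hB
      rw [Finset.mem_inter] at hw
      exact ⟨w, Finset.mem_erase.2 ⟨fun h' => h.2 (h' ▸ hw.2), hw.1⟩, h.1, hw.2, h.2⟩
    have h2 : ∑ z ∈ A.erase y, cnt F (fun B => x ∈ B ∧ z ∈ B ∧ y ∉ B) ≤
        (A.erase y).card • (U + 2 * supCount n k 4) := by
      refine Finset.sum_le_card_nsmul _ _ _ fun z hz => ?_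
      rw [Finset.mem_erase] at hz
      exact hdegB z (fun h => hxA (h ▸ hz.2)) hz.1.symm
    rw [Finset.card_erase_of_mem hyA, hF A hAF, smul_eq_mul, mul_add, mul_left_comm] at h2
    omega
  have hno : ∀ B ∈ F, x ∉ B → y ∉ B → False := by
    -- Otherwise every member with y but not x contains z and meets B, giving at most kU of them.
    have hzmem : ∀ B ∈ F, x ∉ B → y ∉ B → z ∈ B := by
      intro B hBF hxB hyB
      by_contra hzB'
      have h1 := cnt_pair_meeting_le hF hyz hyB hzB'
      rw [hF B hBF, ← hUdef] at h1
      have h2 : cnt F (fun A => y ∈ A ∧ x ∉ A) ≤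
          cnt F (fun A => y ∈ A ∧ z ∈ A ∧ (A ∩ B).Nonempty) :=
        cnt_mono fun A hA h => ⟨h.1, hzA A hA h.1 h.2, hm A hA B hBF⟩
      omega
    intro B hBF hxB hyB
    have hzB' := hzmem B hBF hxB hyB
    have h1 := cnt_pair_meeting_le hF hxy (T := B.erase z)
      (fun h => hxB (Finset.mem_of_mem_erase h)) (fun h => hyB (Finset.mem_of_mem_erase h))
    rw [Finset.card_erase_of_mem hzB', hF B hBF, ← hUdef] at h1
    -- A member missing z must contain x and y, and it meets B outside z; this leaves at most
    -- (k-1)U, against (k+5)U.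
    have h2 : cnt F (fun A => z ∉ A) ≤
        cnt F (fun A => x ∈ A ∧ y ∈ A ∧ (A ∩ B.erase z).Nonempty) := cnt_mono fun A hA h => by
      have h3 := hzA A hA
      have h4 := hzB A hA
      have h5 := hzmem A hA
      obtain ⟨w, hw⟩ := hm A hA B hBF
      rw [Finset.mem_inter] at hw
      have h6 : (A ∩ B.erase z).Nonempty :=
        ⟨w, Finset.mem_inter.2 ⟨hw.1, Finset.mem_erase.2 ⟨fun h' => h (h' ▸ hw.1), hw.2⟩⟩⟩
      tauto
    have h3 := hdiv z
    omega
  refine ⟨z, hxz, hyz, fun A hA => ?_⟩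
  have h1 := hzA A hA
  have h2 := hzB A hA
  have h3 := hno A hA
  tauto

/-- For k = 2 pairwise meeting edges without a common vertex form a triangle; the counting above is
void there because U = 0. -/
theorem exists_triangle_of_card_eq_two (hF : ∀ A ∈ F, A.card = 2) (hm : Meets F)
    (hne : F.Nonempty) (hdiv : ∀ x, ∃ A ∈ F, x ∉ A) :
    ∃ u v w : Fin n, u ≠ v ∧ u ≠ w ∧ v ≠ w ∧
      ∀ A ∈ F, u ∈ A ∧ v ∈ A ∨ u ∈ A ∧ w ∈ A ∨ v ∈ A ∧ w ∈ A := by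
  have hother : ∀ A ∈ F, ∀ a ∈ A, ∃ b, a ≠ b ∧ A = {a, b} := by
    intro A hA a ha
    obtain ⟨c, d, hcd, rfl⟩ := Finset.card_eq_two.1 (hF A hA)
    rw [Finset.mem_insert, Finset.mem_singleton] at ha
    rcases ha with rfl | rfl
    · exact ⟨d, hcd, rfl⟩
    · exact ⟨c, hcd.symm, Finset.pair_comm _ _⟩
  obtain ⟨A, hA⟩ := hne
  obtain ⟨a, ha⟩ := Finset.card_pos.1 (by rw [hF A hA]; norm_num : 0 < A.card)
  obtain ⟨b, hab, rfl⟩ := hother A hA a ha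
  obtain ⟨C, hC, haC⟩ := hdiv a
  have hmem : ∀ c d, ({c, d} : Finset (Fin n)) ∈ F → ∀ E ∈ F, c ∈ E ∨ d ∈ E := by
    intro c d hcd E hE
    obtain ⟨w, hw⟩ := hm _ hcd E hE
    simp only [Finset.mem_inter, Finset.mem_insert, Finset.mem_singleton] at hw
    rcases hw with ⟨rfl | rfl, h⟩
    · exact Or.inl h
    · exact Or.inr h
  obtain ⟨c, hbc, rfl⟩ := hother C hC b ((hmem a b hA C hC).resolve_left haC)
  have hac : a ≠ c := by
    rintro rfl
    simp at haC
  obtain ⟨D, hD, hbD⟩ := hdiv b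
  have haD := (hmem a b hA D hD).resolve_right hbD
  have hcD := (hmem b c hC D hD).resolve_left hbD
  obtain ⟨e, hae, rfl⟩ := hother D hD a haD
  have hce : c = e := by simpa [hac.symm] using hcD
  subst hce
  refine ⟨a, b, c, hab, hac, hbc, fun E hE => ?_⟩
  have h1 := hmem a b hA E hE
  have h2 := hmem b c hC E hE
  have h3 := hmem a c hD E hE
  tauto

end Triangle

/-! ### Translating the diversity -/

section Diversity

variable {n k : ℕ} {F : Finset (Finset (Fin n))}

theorem famDiversity_le_cnt (F : Finset (Finset (Fin n))) (x : Fin n) :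
    famDiversity F ≤ cnt F (fun A => x ∉ A) := by
  have h1 : famDegree F x ≤ famMaxDegree F := Finset.le_sup (Finset.mem_univ x)
  have h2 : famDegree F x = cnt F (fun A => x ∈ A) := (cnt_eq_card_filter F _).symm
  have h3 : cnt F (fun _ => True) ≤ _ := cnt_le_add
    (q := fun A => x ∈ A) (s := fun A => x ∉ A) (fun A _ _ => em _)
  rw [cnt_true] at h3
  unfold famDiversity
  omega

theorem cnt_missing_one_le (u : Fin n) {v w : Fin n} (huv : u ≠ v) (huw : u ≠ w) (hvw : v ≠ w) :
    cnt ((Finset.univ : Finset (Fin n)).powersetCard k) (fun A => u ∉ A ∧ v ∈ A ∧ w ∈ A) ≤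
      (n - 3).choose (k - 2) := by
  classical
  have hcard : (({u, v, w} : Finset (Fin n))ᶜ).card = n - 3 := by
    rw [Finset.card_compl, Fintype.card_fin, Finset.card_eq_three.2 ⟨u, v, w, huv, huw, hvw, rfl⟩]
  rw [cnt_eq_card_filter, ← hcard, ← Finset.card_powersetCard]
  refine Finset.card_le_card_of_injOn (fun A => A \ {v, w}) (fun A hA => ?_) ?_
  · simp only [Finset.coe_filter, Finset.mem_powersetCard, Set.mem_ofPred_eq] at hA
    have hsub : ({v, w} : Finset (Fin n)) ⊆ A := by
      simp [Finset.insert_subset_iff, hA.2.2.1, hA.2.2.2]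
    rw [Finset.mem_coe, Finset.mem_powersetCard, Finset.card_sdiff_of_subset hsub,
      Finset.card_pair hvw, hA.1.2]
    refine ⟨fun z hz => ?_, rfl⟩
    simp only [Finset.mem_sdiff, Finset.mem_insert, Finset.mem_singleton, Finset.mem_compl] at hz ⊢
    rintro (rfl | h)
    · exact hA.2.1 hz.1
    · exact hz.2 h
  · intro A hA B hB hAB
    simp only [Finset.coe_filter, Set.mem_ofPred_eq] at hA hB
    have hsub : ∀ A : Finset (Fin n), v ∈ A ∧ w ∈ A → A \ {v, w} ∪ {v, w} = A := fun A h =>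
      Finset.sdiff_union_of_subset (by simp [Finset.insert_subset_iff, h.1, h.2])
    rw [← hsub A hA.2.2, ← hsub B hB.2.2]
    exact congrArg (· ∪ {v, w}) hAB

/-- The members missing u are all of this kind, and they number |F| - deg u ≥ γ(F). -/
theorem cnt_sdiff_missing_one_add_le (hFk : F ⊆ Finset.univ.powersetCard k) {u v w : Fin n}
    (huv : u ≠ v) (huw : u ≠ w) (hvw : v ≠ w) (hF : ∀ A ∈ F, u ∉ A → v ∈ A ∧ w ∈ A) :
    (cnt (Finset.univ.powersetCard k \ F) (fun A => u ∉ A ∧ v ∈ A ∧ w ∈ A) : ℤ) + famDiversity F ≤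
      ((n - 3).choose (k - 2) : ℕ) := by
  classical
  have h1 := cnt_missing_one_le (k := k) u huv huw hvw
  have h2 := famDiversity_le_cnt F u
  have h3 : cnt F (fun A => u ∉ A) ≤ cnt F (fun A => u ∉ A ∧ v ∈ A ∧ w ∈ A) :=
    cnt_mono fun A hA h => ⟨h, hF A hA h⟩
  have h4 := cnt_sdiff_add_cnt hFk (p := fun A => u ∉ A ∧ v ∈ A ∧ w ∈ A)
  omega

theorem card_inter_triple {u v w : Fin n} (huv : u ≠ v) (huw : u ≠ w) (hvw : v ≠ w)
    (A : Finset (Fin n)) : (A ∩ {u, v, w}).card =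
      (if u ∈ A then 1 else 0) + (if v ∈ A then 1 else 0) + (if w ∈ A then 1 else 0) := by
  rw [Finset.inter_comm, ← Finset.filter_mem_eq_inter, Finset.card_filter,
    Finset.sum_insert (by simp [huv, huw]), Finset.sum_pair hvw, add_assoc]

theorem card_triangleFamily_sdiff_add_le (hFk : F ⊆ Finset.univ.powersetCard k) {u v w : Fin n}
    (huv : u ≠ v) (huw : u ≠ w) (hvw : v ≠ w)
    (hF : ∀ A ∈ F, u ∈ A ∧ v ∈ A ∨ u ∈ A ∧ w ∈ A ∨ v ∈ A ∧ w ∈ A) :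
    ((triangleFamily n k u v w \ F).card : ℤ) + 3 * famDiversity F ≤
      3 * ((n - 3).choose (k - 2) : ℕ) := by
  have h1 := cnt_sdiff_missing_one_add_le hFk huv huw hvw
    (fun A hA h => by have := hF A hA; tauto)
  have h2 := cnt_sdiff_missing_one_add_le hFk huv.symm hvw huw
    (fun A hA h => by have := hF A hA; tauto)
  have h3 := cnt_sdiff_missing_one_add_le hFk huw.symm hvw.symm huv
    (fun A hA h => by have := hF A hA; tauto)
  have h4 : cnt (triangleFamily n k u v w \ F) (fun _ => True) ≤ _ := cnt_le_add_add
    (q := fun A => u ∉ A ∧ v ∈ A ∧ w ∈ A) (s := fun A => v ∉ A ∧ u ∈ A ∧ w ∈ A)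
    (t := fun A => w ∉ A ∧ u ∈ A ∧ v ∈ A) (fun A hA _ => by
      have h5 := (Finset.mem_filter.1 (Finset.mem_sdiff.1 hA).1).2
      rw [card_inter_triple huv huw hvw] at h5
      by_cases hu : u ∈ A <;> by_cases hv : v ∈ A <;> by_cases hw : w ∈ A <;>
        simp_all)
  have hsub : triangleFamily n k u v w \ F ⊆ Finset.univ.powersetCard k \ F :=
    Finset.sdiff_subset_sdiff (Finset.filter_subset _ _) le_rfl
  have h5 := cnt_subset hsub (p := fun A => u ∉ A ∧ v ∈ A ∧ w ∈ A)
  have h6 := cnt_subset hsub (p := fun A => v ∉ A ∧ u ∈ A ∧ w ∈ A)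
  have h7 := cnt_subset hsub (p := fun A => w ∉ A ∧ u ∈ A ∧ v ∈ A)
  rw [cnt_true] at h4
  omega

theorem supCount_three_mul (hk : 3 ≤ k) (hn : k ≤ n) :
    (n - 3).choose (k - 2) * (k - 2) = supCount n k 3 * (n - k) := by
  have h := Nat.choose_succ_right_eq (n - 3) (k - 3)
  rw [show k - 3 + 1 = k - 2 by omega, show n - 3 - (k - 3) = n - k by omega] at h
  rw [h, supCount, ← Nat.choose_symm (show k - 3 ≤ n - 3 by omega),
    show n - 3 - (k - 3) = n - k by omega]

/-- Here γ = βU(n-k)/(k-2), and β(n-k) ≥ (M-1)k because β ≤ 1. It is used with M = 40, c = 39 and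
with M = k + 4, c = k + 5. -/
theorem mul_supCount_le_of_diversity (hk : 3 ≤ k) (hn : k ≤ n) {β M : ℝ} {g : ℤ} (hβ : β ≤ 1)
    (hg : (g : ℝ) = β * ((n - 3).choose (k - 2) : ℝ)) (hM : M * k ≤ β * n) {c : ℕ}
    (hc : c * ((k : ℝ) - 2) ≤ (M - 1) * k) : ((c * supCount n k 3 : ℕ) : ℤ) ≤ g := by
  have h1 : (((n - 3).choose (k - 2) * (k - 2) : ℕ) : ℝ) = ((supCount n k 3 * (n - k) : ℕ) : ℝ) := by
    rw [supCount_three_mul hk hn]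
  rw [Nat.cast_mul, Nat.cast_mul, Nat.cast_sub (show 2 ≤ k by omega), Nat.cast_sub hn] at h1
  have hk2 : (0 : ℝ) < (k : ℝ) - 2 := by
    have : (3 : ℝ) ≤ k := by exact_mod_cast hk
    linarith
  have hU : (0 : ℝ) ≤ supCount n k 3 := Nat.cast_nonneg _
  have h2 : ((c * supCount n k 3 : ℕ) : ℝ) ≤ g := by
    refine le_of_mul_le_mul_right ?_ hk2
    push_cast at h1 ⊢
    calc (c : ℝ) * supCount n k 3 * (k - 2) = supCount n k 3 * (c * ((k : ℝ) - 2)) := by ring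
      _ ≤ supCount n k 3 * (β * ((n : ℝ) - k)) := by
          refine mul_le_mul_of_nonneg_left (hc.trans ?_) hU
          have : β * (k : ℝ) ≤ 1 * k := mul_le_mul_of_nonneg_right hβ (Nat.cast_nonneg _)
          linarith
      _ = β * (supCount n k 3 * ((n : ℝ) - k)) := by ring
      _ = (g : ℝ) * (k - 2) := by rw [← h1, hg]; ring
  exact_mod_cast h2

end Diversity

theorem corollary1p13 (n k : ℕ) (hk : 2 ≤ k) (F : Finset (Finset (Fin n)))
    (hFk : F ⊆ Finset.univ.powersetCard k)
    (hF : (F : Set (Finset (Fin n))).Intersecting)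
    (α : ℝ) (hα0 : 0 ≤ α) (hα1 : α < 1)
    (hγ : (famDiversity F : ℝ) = (1 - α) * ((n - 3).choose (k - 2) : ℝ))
    (hn : (max (k + 4) 40 : ℝ) * ((k : ℝ) / (1 - α)) ≤ (n : ℝ)) :
    ∃ u v w : Fin n, u ≠ v ∧ u ≠ w ∧ v ≠ w ∧
      F ⊆ triangleFamilyStar n k u v w ∧
      ((triangleFamily n k u v w \ F).card : ℝ) ≤ 3 * α * ((n - 3).choose (k - 2) : ℝ) := by
  have hcard : ∀ A ∈ F, A.card = k := fun A hA => (Finset.mem_powersetCard.1 (hFk hA)).2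
  have hm : Meets F := fun A hA B hB => Finset.not_disjoint_iff_nonempty_inter.1 (hF hA hB)
  have hβ : 0 < 1 - α := by linarith
  have hk0 : (2 : ℝ) ≤ k := by exact_mod_cast hk
  have hMn : (max (k + 4) 40 : ℝ) * k ≤ (1 - α) * n := by
    rw [← mul_div_assoc, div_le_iff₀ hβ] at hn
    linarith
  have hβn : (1 - α) * n ≤ n := by
    have : (1 - α) * n ≤ 1 * n := mul_le_mul_of_nonneg_right (by linarith) (Nat.cast_nonneg _)
    linarith
  have h40 : (40 : ℝ) * k ≤ (1 - α) * n :=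
    (mul_le_mul_of_nonneg_right (le_max_right _ _) (by linarith)).trans hMn
  have hk4 : ((k : ℝ) + 4) * k ≤ (1 - α) * n :=
    (mul_le_mul_of_nonneg_right (le_max_left _ _) (by linarith)).trans hMn
  have hn40 : 40 * k ≤ n := by exact_mod_cast h40.trans hβn
  have hnk4 : (k + 4) * k ≤ n := by exact_mod_cast hk4.trans hβn
  have hdiv := famDiversity_le_cnt F
  obtain ⟨u, v, w, huv, huw, hvw, htri⟩ : ∃ u v w : Fin n, u ≠ v ∧ u ≠ w ∧ v ≠ w ∧
      ∀ A ∈ F, u ∈ A ∧ v ∈ A ∨ u ∈ A ∧ w ∈ A ∨ v ∈ A ∧ w ∈ A := by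
    rcases hk.eq_or_lt with rfl | hk3
    · have hpos : 0 < famDiversity F := by
        have : (0 : ℝ) < famDiversity F := by
          rw [hγ]
          simpa using hβ
        exact_mod_cast this
      have hex : ∀ x, ∃ A ∈ F, x ∉ A := fun x =>
        exists_of_cnt_pos (by have := hdiv x; omega)
      obtain ⟨A, hA, -⟩ := hex ⟨0, by omega⟩
      exact exists_triangle_of_card_eq_two hcard hm ⟨A, hA⟩ hex
    · have hk3' : (3 : ℝ) ≤ k := by exact_mod_cast hk3
      have hU : 0 < supCount n k 3 := Nat.choose_pos (by omega)
      have h39 : ∀ x, 39 * supCount n k 3 ≤ cnt F (fun A => x ∉ A) := fun x => by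
        have h1 := mul_supCount_le_of_diversity (c := 39) hk3 (by omega) (by linarith) hγ h40
          (by push_cast; linarith)
        exact_mod_cast h1.trans (hdiv x)
      -- The constant fits since (k+5)(k-2) = k² + 3k - 10 ≤ (k+3)k.
      have hk5 : ∀ x, (k + 5) * supCount n k 3 ≤ cnt F (fun A => x ∉ A) := fun x => by
        have h1 := mul_supCount_le_of_diversity (c := k + 5) hk3 (by omega) (by linarith) hγ hk4
          (by push_cast; nlinarith)
        exact_mod_cast h1.trans (hdiv x)
      have hU4 : (k - 1) * supCount n k 4 ≤ supCount n k 3 := by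
        refine mul_supCount_succ_le (by omega) (by omega) ?_
        obtain ⟨m, rfl⟩ := Nat.exists_eq_add_of_le hk3
        rw [show Nat.succ 2 + m - 1 = m + 2 by omega, show Nat.succ 2 + m - 3 = m by omega]
        have : (m + 2) * m + 3 ≤ (Nat.succ 2 + m + 4) * (Nat.succ 2 + m) := by
          rw [Nat.succ_eq_add_one]
          nlinarith
        omega
      obtain ⟨a, b, hab, hpair⟩ := exists_heavy_pair (by omega) hn40 hU hcard hm h39
      obtain ⟨c, hac, hbc, htri⟩ :=
        exists_third_point (by omega) hn40 hU hU4 hcard hm hk5 hab hpair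
      exact ⟨a, b, c, hab, hac, hbc, htri⟩
  refine ⟨u, v, w, huv, huw, hvw, fun A hA => ?_, ?_⟩
  · refine Finset.mem_filter.2 ⟨hFk hA, ?_⟩
    rw [card_inter_triple huv huw hvw]
    rcases htri A hA with h | h | h <;> simp only [h.1, h.2, if_true] <;> omega
  · have h1 := card_triangleFamily_sdiff_add_le hFk huv huw hvw htri
    have h2 : ((triangleFamily n k u v w \ F).card : ℝ) + 3 * famDiversity F ≤
        3 * ((n - 3).choose (k - 2) : ℕ) := by exact_mod_cast h1
    rw [hγ] at h2
    linarith
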